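/- **Setting.** Let $d\ge 1$, $m\ge 0$. Currents are continuous linear functionals on the space $\mathscr D^m(\mathbb R^d)$ of smooth compactly supported $m$-forms; $\|\omega\|_\infty$ is the supremum of the comass norm, $\mathbf M(T)=\sup\{T(\omega):\|\omega\|_\infty\le 1\}$ is the mass, $\mathbf N(T)=\mathbf M(T)+\mathbf M(\partial T)$ the normal mass (with $\partial T=0$ if $m=0$), and $\mathbf F(T)=\sup\{T(\omega):\max(\|\omega\|_\infty,\|d\omega\|_\infty)\le 1\}$ the flat norm. For $X\subset\mathbb R^d$, $\mathbf N_m(X)$ is the space of $m$-currents with compact support contained in $X$ and finite normal mass. For compact $K$, an *$m$-charge* over $K$ is a linear map $\omega:\mathbf N_m(K)\to\mathbb R$ such that for all $\varepsilon>0$ there is $\theta\ge 0$ with $|\omega(T)|\le\varepsilon\mathbf N(T)+\theta\mathbf F(T)$ for all $T$; $\|\omega\|_{CH^m(K)}=\sup\{\omega(T):\mathbf N(T)\le 1\}$. For $0<\alpha\le 1$, $CH^{m,\alpha}(K)$ is the space of *$\alpha$-fractional* charges: linear maps $\omega:\mathbf N_m(K)\to\mathbb R$ with $|\omega(T)|\le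 C\,\mathbf N(T)^{1-\alpha}\mathbf F(T)^\alpha$ for all $T$, for some $C\ge0$; $\|\omega\|_{CH^{m,\alpha}(K)}$ is the infimum of such $C$. A sequence in $CH^{m,\alpha}(K)$ converges weakly-* to $\omega\in CH^{m,\alpha}(K)$ if it is bounded in $CH^{m,\alpha}(K)$ and converges to $\omega$ in $CH^m(K)$. A charge (respectively an $\alpha$-fractional charge) over $\mathbb R^d$ is a linear functional on $\mathbf N_m(\mathbb R^d)$ whose restriction to $\mathbf N_m(K)$ is a charge (respectively an $\alpha$-fractional charge) for every compact $K$; weak-* convergence in $CH^{m,\alpha}(\mathbb R^d)$ means boundedness in each $\|\cdot\|_{CH^{m,\alpha}(K)}$ and convergence in each $\|\cdot\|_{CH^m(K)}$. **Statement.** Let $0<\alpha<1$. There is a constant $C_\alpha\ge 0$ depending only on $\alpha$ such that for all $d\ge 1$ and $m\ge 0$: 1. Let $K\subset\mathbb R^d$ be compact, $C\ge 0$, and let $(\omega_n)_{n\ge0}$ be a sequence in $CH^{m,1}(K)$ with $$\|\omega_n\|_{CH^{m,1}(K)}\le C\,2^{n(1-\alpha)},\qquad \|\omega_n\|_{CH^m(K)}\le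 C\,2^{-n\alpha}\qquad\text{for all } n\ge 0.$$ Then $\sum_{n\ge0}\omega_n$ converges weakly-* in $CH^{m,\alpha}(K)$ to an $\alpha$-fractional charge, and $\big\|\sum_{n\ge0}\omega_n\big\|_{CH^{m,\alpha}(K)}\le C_\alpha C$. 2. Let $(\omega_n)_{n\ge 0}$ be a sequence in $CH^{m,1}(\mathbb R^d)$ such that for each compact $K$ there is $C_K\ge 0$ with $\|\omega_n\|_{CH^{m,1}(K)}\le C_K2^{n(1-\alpha)}$ and $\|\omega_n\|_{CH^m(K)}\le C_K2^{-n\alpha}$ for all $n$. Then $\sum_{n\ge0}\omega_n$ converges weakly-* to a charge in $CH^{m,\alpha}(\mathbb R^d)$, and $\big\|\sum_{n\ge0}\omega_n\big\|_{CH^{m,\alpha}(K)}\le C_\alpha C_K$ for every compact $K$. 3. (Littlewood–Paley decomposition.) Let $\Phi\in C_c^\infty(\mathbb R^d)$ be nonnegative and even, with support in the closed unit ball and $\int\Phi=1$; put $\Phi_\varepsilon(x)=\varepsilon^{-d}\Phi(\varepsilon^{-1}x)$. For currents let $(T*\phi)(\eta)=T(\check\phi*\eta)$, where $\check\phi(x)=\phi(-x)$,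 and for charges let $(\omega*\phi)(T)=\omega(T*\check\phi)$. Let $\omega\in CH^{m,\alpha}(\mathbb R^d)$, $\omega_0=\omega*\Phi_1$ and $\omega_{n+1}=\omega*\Phi_{2^{-(n+1)}}-\omega*\Phi_{2^{-n}}$ for $n\ge0$. Then $(\omega_n)$ satisfies the hypotheses of part 2, and $$\omega=\sum_{n\ge 0}\omega_n=\omega*\Phi_1+\sum_{n=0}^\infty\big(\omega*\Phi_{2^{-(n+1)}}-\omega*\Phi_{2^{-n}}\big)$$ weakly-* in $CH^{m,\alpha}(\mathbb R^d)$. -/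

import Mathlib

open MeasureTheory Filter Topology TopologicalSpace Set
open scoped Distributions ENNReal NNReal Convolution Pointwise

noncomputable section

namespace FractionalCharge

/-! ### Test forms and currents -/

/-- The Euclidean space `ℝ^d`. -/
abbrev Euc (d : ℕ) : Type := EuclideanSpace ℝ (Fin d)

/-- `m`-covectors of `ℝ^d`. The operator norm of an alternating map, that is the supremum of
`|φ (v₁, …, v_m)|` over all vectors `v_i` of Euclidean length at most one, is the comass norm. -/
abbrev Covector (d m : ℕ) : Type := Euc d [⋀^Fin m]→L[ℝ] ℝ

/-- Smooth functions with compact support on `ℝ^d`, with values in `F`. -/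
abbrev Test (d : ℕ) (F : Type) [NormedAddCommGroup F] [NormedSpace ℝ F] : Type :=
  𝓓((⊤ : Opens (Euc d)), F)

/-- The space `𝒟^m(ℝ^d)` of smooth compactly supported `m`-forms, with its LF topology. -/
abbrev Form (d m : ℕ) : Type := Test d (Covector d m)

/-- The exterior derivative of test forms, as a continuous linear map. -/
def extD (d m : ℕ) : Form d m →L[ℝ] Form d (m + 1) :=
  TestFunction.postcompCLM
      (ContinuousAlternatingMap.alternatizeUncurryFinCLM (n := m) ℝ (Euc d) ℝ) ∘L
    TestFunction.fderivCLM ℝ ⊤ ⊤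

theorem extD_apply {d m : ℕ} (ω : Form d m) (x : Euc d) : extD d m ω x = extDeriv ω x := by
  simp [extD, extDeriv]

/-- `m`-dimensional currents in `ℝ^d`: continuous linear functionals on test `m`-forms. -/
abbrev Current (d m : ℕ) : Type := Form d m →L[ℝ] ℝ

/-- The boundary of a current, `∂T(ω) = T(dω)`. -/
def boundary {d m : ℕ} (T : Current d (m + 1)) : Current d m := T ∘L extD d m

/-- The mass of a current, `sup {T(ω) : ‖ω‖_∞ ≤ 1}`, with respect to the comass norm. -/
def mass {d m : ℕ} (T : Current d m) : ℝ≥0∞ :=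
  ⨆ (ω : Form d m) (_ : ∀ x, ‖ω x‖ ≤ 1), ENNReal.ofReal (T ω)

/-- The mass of the boundary; the boundary of a `0`-current is zero. -/
def boundaryMass {d : ℕ} : {m : ℕ} → Current d m → ℝ≥0∞
  | 0, _ => 0
  | _ + 1, T => mass (boundary T)

/-- The normal mass `M(T) + M(∂T)`. -/
def normalMass {d m : ℕ} (T : Current d m) : ℝ≥0∞ := mass T + boundaryMass T

/-- The flat norm `sup {T(ω) : max (‖ω‖_∞, ‖dω‖_∞) ≤ 1}`. -/
def flatNorm {d m : ℕ} (T : Current d m) : ℝ≥0∞ :=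
  ⨆ (ω : Form d m) (_ : (∀ x, ‖ω x‖ ≤ 1) ∧ ∀ x, ‖extDeriv ω x‖ ≤ 1), ENNReal.ofReal (T ω)

/-- The support of a current. -/
abbrev spt {d m : ℕ} (T : Current d m) : Set (Euc d) := Distribution.dsupport T

theorem spt_add {d m : ℕ} (T S : Current d m) : spt (T + S) ⊆ spt T ∪ spt S := by
  intro x hx
  by_contra h
  simp only [mem_union, not_or, spt, Distribution.notMem_dsupport_iff] at h
  obtain ⟨⟨s, hs, hso, hxs⟩, t, ht, hto, hxt⟩ := h
  refine (Distribution.notMem_dsupport_iff (f := T + S) x).2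
    ⟨s ∩ t, fun u hu => ?_, hso.inter hto, hxs, hxt⟩ hx
  have h1 := hs u (hu.trans inter_subset_left)
  have h2 := ht u (hu.trans inter_subset_right)
  simp [h1, h2]

theorem spt_smul {d m : ℕ} (c : ℝ) (T : Current d m) : spt (c • T) ⊆ spt T :=
  Distribution.dsupport_subset_dsupport fun s _ hT u hu => by simp [hT u hu]

theorem spt_zero {d m : ℕ} : spt (0 : Current d m) = ∅ := by
  ext x
  simp only [mem_empty_iff_false, iff_false, Distribution.notMem_dsupport_iff]
  exact ⟨univ, fun u _ => by simp, isOpen_univ, mem_univ x⟩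

theorem mass_add {d m : ℕ} (T S : Current d m) : mass (T + S) ≤ mass T + mass S := by
  refine iSup₂_le fun ω hω => ?_
  rw [add_apply]
  exact ENNReal.ofReal_add_le.trans (add_le_add
    (le_iSup₂ (f := fun (ω : Form d m) (_ : ∀ x, ‖ω x‖ ≤ 1) => ENNReal.ofReal (T ω)) ω hω)
    (le_iSup₂ (f := fun (ω : Form d m) (_ : ∀ x, ‖ω x‖ ≤ 1) => ENNReal.ofReal (S ω)) ω hω))

theorem mass_smul {d m : ℕ} (c : ℝ) (T : Current d m) :
    mass (c • T) ≤ ENNReal.ofReal |c| * mass T := by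
  have key : ∀ ω : Form d m, (∀ x, ‖ω x‖ ≤ 1) → ENNReal.ofReal (T ω) ≤ mass T := fun ω hω =>
    le_iSup₂ (f := fun (ω : Form d m) (_ : ∀ x, ‖ω x‖ ≤ 1) => ENNReal.ofReal (T ω)) ω hω
  refine iSup₂_le fun ω hω => ?_
  rcases le_total 0 c with hc | hc
  · have : (c • T) ω = |c| * T ω := by simp [abs_of_nonneg hc]
    rw [this, ENNReal.ofReal_mul (abs_nonneg c)]
    gcongr
    exact key ω hω
  · have : (c • T) ω = |c| * T (-ω) := by simp [abs_of_nonpos hc]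
    rw [this, ENNReal.ofReal_mul (abs_nonneg c)]
    gcongr
    exact key (-ω) fun x => by simpa using hω x

theorem boundaryMass_add {d m : ℕ} (T S : Current d m) :
    boundaryMass (T + S) ≤ boundaryMass T + boundaryMass S := by
  cases m with
  | zero => simp [boundaryMass]
  | succ m => exact mass_add (boundary T) (boundary S)

theorem boundaryMass_smul {d m : ℕ} (c : ℝ) (T : Current d m) :
    boundaryMass (c • T) ≤ ENNReal.ofReal |c| * boundaryMass T := by
  cases m with
  | zero => simp [boundaryMass]
  | succ m => exact mass_smul c (boundary T)

/-- The space `N_m(X)` of normal currents (currents with compact support and finite normal mass)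
whose support is contained in `X`. -/
def normalCurrents (d m : ℕ) (X : Set (Euc d)) : Submodule ℝ (Current d m) where
  carrier := {T | IsCompact (spt T) ∧ normalMass T ≠ ∞ ∧ spt T ⊆ X}
  zero_mem' := by
    refine ⟨by rw [spt_zero]; exact isCompact_empty, ?_, by rw [spt_zero]; exact empty_subset X⟩
    have h1 : mass (0 : Current d m) = 0 := by simp [mass]
    have h2 : boundaryMass (0 : Current d m) = 0 := by
      cases m with
      | zero => rfl
      | succ m => simp [boundaryMass, boundary, mass]
    simp [normalMass, h1, h2]
  add_mem' := by
    rintro T S ⟨hT, hT', hTX⟩ ⟨hS, hS', hSX⟩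
    refine ⟨(hT.union hS).of_isClosed_subset Distribution.isClosed_dsupport (spt_add T S), ?_,
      (spt_add T S).trans (union_subset hTX hSX)⟩
    refine ne_top_of_le_ne_top (ENNReal.add_ne_top.2 ⟨hT', hS'⟩) ?_
    calc normalMass (T + S) ≤ (mass T + mass S) + (boundaryMass T + boundaryMass S) :=
          add_le_add (mass_add T S) (boundaryMass_add T S)
      _ = normalMass T + normalMass S := by rw [normalMass, normalMass]; ring
  smul_mem' := by
    rintro c T ⟨hT, hT', hTX⟩
    refine ⟨hT.of_isClosed_subset Distribution.isClosed_dsupport (spt_smul c T), ?_,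
      (spt_smul c T).trans hTX⟩
    refine ne_top_of_le_ne_top (ENNReal.mul_ne_top (ENNReal.ofReal_ne_top (r := |c|)) hT') ?_
    calc normalMass (c • T) ≤ ENNReal.ofReal |c| * mass T + ENNReal.ofReal |c| * boundaryMass T :=
          add_le_add (mass_smul c T) (boundaryMass_smul c T)
      _ = ENNReal.ofReal |c| * normalMass T := by rw [normalMass]; ring

theorem normalCurrents_mono {d m : ℕ} {X Y : Set (Euc d)} (h : X ⊆ Y) :
    normalCurrents d m X ≤ normalCurrents d m Y :=
  fun _ hT => ⟨hT.1, hT.2.1, hT.2.2.trans h⟩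

/-! ### Charges over a set of `ℝ^d` -/

/-- Linear functionals on `N_m(X)`. -/
abbrev Cochain (d m : ℕ) (X : Set (Euc d)) : Type := normalCurrents d m X →ₗ[ℝ] ℝ

/-- The normal mass of a normal current, a real number. -/
def nMass {d m : ℕ} {X : Set (Euc d)} (T : normalCurrents d m X) : ℝ :=
  (normalMass (T : Current d m)).toReal

/-- The flat norm of a normal current, a real number (it is at most the mass). -/
def fNorm {d m : ℕ} {X : Set (Euc d)} (T : normalCurrents d m X) : ℝ :=
  (flatNorm (T : Current d m)).toReal

/-- `ω` is an `m`-charge over the compact set `K`. -/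
def IsCharge {d m : ℕ} {K : Set (Euc d)} (ω : Cochain d m K) : Prop :=
  ∀ ε : ℝ, 0 < ε → ∃ θ : ℝ, 0 ≤ θ ∧ ∀ T, |ω T| ≤ ε * nMass T + θ * fNorm T

/-- The norm of `CH^m(K)`. -/
def chargeNorm {d m : ℕ} {K : Set (Euc d)} (ω : Cochain d m K) : ℝ≥0∞ :=
  ⨆ (T : normalCurrents d m K) (_ : nMass T ≤ 1), ENNReal.ofReal (ω T)

/-- `|ω(T)| ≤ C N(T)^{1-α} F(T)^α` for all `T ∈ N_m(K)`. -/
def FracBound {d m : ℕ} {K : Set (Euc d)} (α C : ℝ) (ω : Cochain d m K) : Prop :=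
  ∀ T, |ω T| ≤ C * nMass T ^ (1 - α) * fNorm T ^ α

/-- `ω` is an `α`-fractional `m`-charge over the compact set `K`: it belongs to `CH^{m,α}(K)`. -/
def IsFractionalCharge {d m : ℕ} {K : Set (Euc d)} (α : ℝ) (ω : Cochain d m K) : Prop :=
  ∃ C : ℝ, 0 ≤ C ∧ FracBound α C ω

/-- The norm of `CH^{m,α}(K)`, equal to `∞` if `ω` is not `α`-fractional. -/
def fracNorm {d m : ℕ} {K : Set (Euc d)} (α : ℝ) (ω : Cochain d m K) : ℝ≥0∞ :=
  ⨅ (C : ℝ≥0) (_ : FracBound α C ω), (C : ℝ≥0∞)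

/-- Weak* convergence in `CH^{m,α}(K)` of a sequence of `α`-fractional charges to an
`α`-fractional charge: the sequence is bounded in `CH^{m,α}(K)` and converges in `CH^m(K)`. -/
def WeakStarTendsto {d m : ℕ} {K : Set (Euc d)} (α : ℝ) (u : ℕ → Cochain d m K)
    (ω : Cochain d m K) : Prop :=
  (∀ n, IsFractionalCharge α (u n)) ∧ IsFractionalCharge α ω ∧
    (∃ B : ℝ≥0, ∀ n, fracNorm α (u n) ≤ B) ∧
    Tendsto (fun n => chargeNorm (u n - ω)) atTop (𝓝 0)

/-! ### Charges over `ℝ^d` -/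

/-- Restriction to `N_m(K)` of a linear functional on `N_m(ℝ^d)`. -/
def restrictCharge {d m : ℕ} (K : Set (Euc d)) (ω : Cochain d m univ) : Cochain d m K :=
  ω ∘ₗ Submodule.inclusion (normalCurrents_mono (subset_univ K))

/-- `ω` is an `m`-charge over `ℝ^d`. -/
def IsGlobalCharge {d m : ℕ} (ω : Cochain d m univ) : Prop :=
  ∀ K : Set (Euc d), IsCompact K → IsCharge (restrictCharge K ω)

/-- `ω` is an `α`-fractional `m`-charge over `ℝ^d`: it belongs to `CH^{m,α}(ℝ^d)`. -/
def IsGlobalFractionalCharge {d m : ℕ} (α : ℝ) (ω : Cochain d m univ) : Prop :=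
  IsGlobalCharge ω ∧ ∀ K : Set (Euc d), IsCompact K → IsFractionalCharge α (restrictCharge K ω)

/-- Weak* convergence in `CH^{m,α}(ℝ^d)`: boundedness for each of the seminorms of
`CH^{m,α}(ℝ^d)` and convergence in `CH^m(ℝ^d)`. -/
def GlobalWeakStarTendsto {d m : ℕ} (α : ℝ) (u : ℕ → Cochain d m univ)
    (ω : Cochain d m univ) : Prop :=
  (∀ n, IsGlobalFractionalCharge α (u n)) ∧ IsGlobalFractionalCharge α ω ∧
    (∀ K : Set (Euc d), IsCompact K → ∃ B : ℝ≥0, ∀ n, fracNorm α (restrictCharge K (u n)) ≤ B) ∧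
    ∀ K : Set (Euc d), IsCompact K →
      Tendsto (fun n => chargeNorm (restrictCharge K (u n - ω))) atTop (𝓝 0)

/-! ### Convolution -/

section Convolution

variable {d : ℕ} {F : Type} [NormedAddCommGroup F] [NormedSpace ℝ F]

/-- The convolution `x ↦ ∫ ψ(y) f(x - y) dy`. -/
def convFun (ψ : Test d ℝ) (f : Euc d → F) : Euc d → F :=
  ψ ⋆[ContinuousLinearMap.lsmul ℝ ℝ, volume] f

theorem convFun_apply (ψ : Test d ℝ) (f : Euc d → F) (x : Euc d) :
    convFun ψ f x = ∫ y, ψ y • f (x - y) := rfl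

theorem test_locallyIntegrable (ψ : Test d ℝ) : LocallyIntegrable (ψ : Euc d → ℝ) volume :=
  ψ.continuous.locallyIntegrable

theorem test_integrable (ψ : Test d ℝ) : Integrable (ψ : Euc d → ℝ) volume :=
  ψ.continuous.integrable_of_hasCompactSupport ψ.hasCompactSupport

theorem conv_integrable (ψ : Test d ℝ) {f : Euc d → F} (hf : Continuous f) (x : Euc d) :
    Integrable (fun y => ψ y • f (x - y)) volume := by
  refine Continuous.integrable_of_hasCompactSupport ?_ ψ.hasCompactSupport.smul_right
  exact ψ.continuous.smul (hf.comp (continuous_const.sub continuous_id))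

theorem norm_convFun_le (ψ : Test d ℝ) {f : Euc d → F} {B : ℝ} (hB : ∀ x, ‖f x‖ ≤ B)
    (x : Euc d) : ‖convFun ψ f x‖ ≤ (∫ y, ‖ψ y‖) * B := by
  rw [convFun_apply, ← integral_mul_const]
  refine norm_integral_le_of_norm_le ((test_integrable ψ).norm.mul_const B)
    (Eventually.of_forall fun y => ?_)
  rw [norm_smul]
  exact mul_le_mul_of_nonneg_left (hB _) (norm_nonneg _)

theorem contDiff_convFun (ψ : Test d ℝ) {f : Euc d → F} (hf : ContDiff ℝ (⊤ : ℕ∞) f)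
    (hc : HasCompactSupport f) : ContDiff ℝ (⊤ : ℕ∞) (convFun ψ f) :=
  hc.contDiff_convolution_right _ (test_locallyIntegrable ψ) hf

theorem fderiv_convFun (ψ : Test d ℝ) {f : Euc d → F} (hf : ContDiff ℝ (⊤ : ℕ∞) f)
    (hc : HasCompactSupport f) : fderiv ℝ (convFun ψ f) = convFun ψ (fderiv ℝ f) := by
  funext x
  exact (hc.hasFDerivAt_convolution_right (ContinuousLinearMap.lsmul ℝ ℝ)
    (test_locallyIntegrable ψ) (hf.of_le (by norm_cast)) x).fderiv

theorem support_convFun (ψ : Test d ℝ) (f : Euc d → F) :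
    Function.support (convFun ψ f) ⊆ tsupport ψ + Function.support f :=
  (support_convolution_subset _).trans (add_subset_add_right subset_closure)

end Convolution

theorem norm_iteratedFDeriv_convFun_le {d : ℕ} (ψ : Test d ℝ) (i : ℕ) :
    ∀ {F : Type} [NormedAddCommGroup F] [NormedSpace ℝ F] {f : Euc d → F} {B : ℝ},
      ContDiff ℝ (⊤ : ℕ∞) f → HasCompactSupport f → (∀ x, ‖iteratedFDeriv ℝ i f x‖ ≤ B) →
      ∀ x, ‖iteratedFDeriv ℝ i (convFun ψ f) x‖ ≤ (∫ y, ‖ψ y‖) * B := by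
  induction i with
  | zero =>
    intro F _ _ f B _ _ hB x
    simp only [norm_iteratedFDeriv_zero] at hB ⊢
    exact norm_convFun_le ψ hB x
  | succ i ih =>
    intro F _ _ f B hf hc hB x
    rw [← norm_iteratedFDeriv_fderiv, fderiv_convFun ψ hf hc]
    refine ih (hf.fderiv_right (by norm_cast)) (hc.fderiv ℝ) (fun y => ?_) x
    rw [norm_iteratedFDeriv_fderiv]
    exact hB y

section Convolution

variable {d : ℕ} {F : Type} [NormedAddCommGroup F] [NormedSpace ℝ F]

/-- Convolution with `ψ` of smooth maps supported in the compact set `K`. -/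
def convSupportedIn (ψ : Test d ℝ) (F : Type) [NormedAddCommGroup F] [NormedSpace ℝ F]
    (K L : Compacts (Euc d)) (h : tsupport ψ + (K : Set (Euc d)) ⊆ L) :
    𝓓_{K}(Euc d, F) →L[ℝ] 𝓓_{L}(Euc d, F) :=
  ContDiffMapSupportedIn.mkCLM ℝ (fun f => convFun ψ f)
    (fun f g x => by
      simp only [convFun_apply, FunLike.coe_add, Pi.add_apply, smul_add]
      exact integral_add (conv_integrable ψ f.continuous x) (conv_integrable ψ g.continuous x))
    (fun c f x => by
      simp only [convFun_apply, FunLike.coe_smul, Pi.smul_apply, smul_comm _ c]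
      exact integral_smul c _)
    (fun f => contDiff_convFun ψ f.contDiff f.hasCompactSupport)
    (fun f x hx => by
      by_contra h0
      exact hx (h (add_subset_add_left f.support_subset (support_convFun ψ f h0))))
    (fun i _ => ⟨{i}, ∫ y, ‖ψ y‖, integral_nonneg fun _ => norm_nonneg _, fun f x _ =>
      norm_iteratedFDeriv_convFun_le ψ i f.contDiff f.hasCompactSupport (fun y => by
        simpa using ContDiffMapSupportedIn.norm_iteratedFDeriv_apply_le_seminorm_top ℝ) x⟩)

/-- The compact set `spt ψ + K`. -/
def convCompact (ψ : Test d ℝ) (K : Compacts (Euc d)) : Compacts (Euc d) :=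
  ⟨tsupport ψ + (K : Set (Euc d)), ψ.hasCompactSupport.isCompact.add K.isCompact⟩

/-- The convolution `ψ * f` of two test functions. -/
def convTestFun (ψ : Test d ℝ) (f : Test d F) : Test d F where
  toFun := convFun ψ f
  contDiff' := contDiff_convFun ψ f.contDiff f.hasCompactSupport
  hasCompactSupport' := ψ.hasCompactSupport.convolution _ f.hasCompactSupport
  tsupport_subset' := fun _ _ => trivial

/-- The convolution `ψ * f` of a test function `f` with `ψ`, as a continuous linear map in `f`. -/
def convTest (ψ : Test d ℝ) (F : Type) [NormedAddCommGroup F] [NormedSpace ℝ F] :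
    Test d F →L[ℝ] Test d F :=
  TestFunction.limitCLM ℝ (convTestFun ψ)
    (fun K _ => (TestFunction.ofSupportedInCLM ℝ (Ω := (⊤ : Opens (Euc d)))
      (K := convCompact ψ K) (fun _ _ => trivial)).comp
        (convSupportedIn ψ F K (convCompact ψ K) (subset_refl _)))
    (fun _ _ _ => TestFunction.ext fun _ => rfl)

theorem convTest_apply (ψ : Test d ℝ) (f : Test d F) (x : Euc d) :
    convTest ψ F f x = ∫ y, ψ y • f (x - y) := rfl

end Convolution

/-- The reflected function `φ(-x)`. -/
def reflect {d : ℕ} (φ : Test d ℝ) : Test d ℝ :=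
  ⟨fun x => φ (-x), φ.contDiff.comp contDiff_neg,
    φ.hasCompactSupport.comp_homeomorph (Homeomorph.neg (Euc d)), subset_univ _⟩

/-- The convolution `T * φ` of a current with a test function: `(T * φ)(ω) = T(φ(-·) * ω)`. -/
def Current.conv {d m : ℕ} (T : Current d m) (φ : Test d ℝ) : Current d m :=
  T ∘L convTest (reflect φ) (Covector d m)

/-- The product of a test form with a smooth function. -/
def mulForm {d m : ℕ} (g : Euc d → ℝ) (hg : ContDiff ℝ (⊤ : ℕ∞) g) (u : Form d m) : Form d m where
  toFun := fun x => g x • u x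
  contDiff' := hg.smul u.contDiff
  hasCompactSupport' :=
    show HasCompactSupport (g • (u : Euc d → Covector d m)) from u.hasCompactSupport.smul_left
  tsupport_subset' := fun _ _ => trivial

theorem eq_zero_of_partition {d m : ℕ} (T : Current d m) (u : Form d m) {ι : Type} [Fintype ι]
    (g : ι → Euc d → ℝ) (hg : ∀ i, ContDiff ℝ (⊤ : ℕ∞) (g i))
    (h1 : ∀ x ∈ tsupport u, ∑ i, g i x = 1)
    (hT : ∀ i, Distribution.IsVanishingOn T (tsupport (g i))) : T u = 0 := by
  have hv : u = ∑ i, mulForm (g i) (hg i) u := by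
    ext1 x
    have hsum : (∑ i, mulForm (g i) (hg i) u) x = ∑ i, g i x • u x := by
      rw [FunLike.coe_sum, Finset.sum_apply]
      rfl
    rw [hsum, ← Finset.sum_smul]
    by_cases hx : x ∈ tsupport u
    · rw [h1 x hx, one_smul]
    · rw [image_eq_zero_of_notMem_tsupport hx, smul_zero]
  rw [hv, map_sum]
  exact Finset.sum_eq_zero fun i _ => hT i _ (tsupport_smul_subset_left (g i) u)

theorem apply_eq_zero_of_disjoint_spt {d m : ℕ} (T : Current d m) {u : Form d m}
    (hu : Disjoint (tsupport u) (spt T)) : T u = 0 := by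
  have hcov : ∀ x ∈ tsupport u, ∃ s : Set (Euc d),
      Distribution.IsVanishingOn T s ∧ IsOpen s ∧ x ∈ s := fun x hx =>
    (Distribution.notMem_dsupport_iff x).1 (disjoint_left.1 hu hx)
  choose! U hU hUo hxU using hcov
  obtain ⟨t, ht, htc⟩ := u.hasCompactSupport.isCompact.elim_nhds_subcover U
    (fun x hx => (hUo x hx).mem_nhds (hxU x hx))
  obtain ⟨f, hf⟩ := SmoothPartitionOfUnity.exists_isSubordinate (modelWithCornersSelf ℝ (Euc d))
    (isClosed_tsupport u) (fun i : t => U i) (fun i => hUo i (ht i i.2))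
    (fun x hx => by
      obtain ⟨i, hi, hxi⟩ := mem_iUnion₂.1 (htc hx)
      exact mem_iUnion.2 ⟨⟨i, hi⟩, hxi⟩)
  exact eq_zero_of_partition T u (fun i : t => f i) (fun i => (f i).contMDiff.contDiff)
    (fun x hx => by rw [← finsum_eq_sum_of_fintype, f.sum_eq_one hx])
    (fun i => (hU i (ht i i.2)).mono (hf i))

theorem spt_conv {d m : ℕ} (T : Current d m) (hT : IsCompact (spt T)) (φ : Test d ℝ) :
    spt (T.conv φ) ⊆ spt T + tsupport φ := by
  have hc : IsClosed (spt T + tsupport φ) := (hT.add φ.hasCompactSupport.isCompact).isClosed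
  refine sInter_subset_of_mem ⟨fun u hu => ?_, hc⟩
  refine apply_eq_zero_of_disjoint_spt T (disjoint_left.2 fun x hx hxT => ?_)
  have hcl : IsClosed (tsupport (reflect φ) + tsupport u) :=
    ((reflect φ).hasCompactSupport.isCompact.add u.hasCompactSupport.isCompact).isClosed
  have hx' : x ∈ tsupport (reflect φ) + tsupport u :=
    closure_minimal ((support_convFun (reflect φ) u).trans (add_subset_add_left subset_closure))
      hcl hx
  obtain ⟨a, ha, b, hb, rfl⟩ := hx'
  refine hu hb ⟨a + b, hxT, -a, ?_, by simp⟩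
  have : tsupport (reflect φ) = -tsupport φ :=
    (tsupport_comp_eq_preimage (φ : Euc d → ℝ) (Homeomorph.neg (Euc d)))
  rw [this] at ha
  exact ha

theorem postcomp_convTest {d : ℕ} {F G : Type} [NormedAddCommGroup F] [NormedSpace ℝ F]
    [CompleteSpace F] [NormedAddCommGroup G] [NormedSpace ℝ G] [CompleteSpace G]
    (L : F →L[ℝ] G) (ψ : Test d ℝ) (f : Test d F) :
    TestFunction.postcompCLM L (convTest ψ F f) = convTest ψ G (TestFunction.postcompCLM L f) := by
  ext1 x
  have h := L.integral_comp_comm (conv_integrable ψ f.continuous x)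
  simp only [map_smul] at h
  exact h.symm

theorem fderiv_convTest {d : ℕ} {F : Type} [NormedAddCommGroup F] [NormedSpace ℝ F]
    (ψ : Test d ℝ) (f : Test d F) :
    TestFunction.fderivCLM ℝ ⊤ ⊤ (convTest ψ F f) =
      convTest ψ (Euc d →L[ℝ] F) (TestFunction.fderivCLM ℝ ⊤ ⊤ f) := by
  ext1 x
  rw [TestFunction.fderivCLM_apply_of_le _ (by simp), convTest_apply,
    TestFunction.fderivCLM_apply_of_le _ (by simp)]
  exact congrFun (fderiv_convFun ψ f.contDiff f.hasCompactSupport) x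

theorem extD_convTest {d m : ℕ} (ψ : Test d ℝ) (ω : Form d m) :
    extD d m (convTest ψ _ ω) = convTest ψ _ (extD d m ω) := by
  rw [extD, ContinuousLinearMap.comp_apply, ContinuousLinearMap.comp_apply, fderiv_convTest]
  exact postcomp_convTest _ ψ _

theorem boundary_conv {d m : ℕ} (T : Current d (m + 1)) (φ : Test d ℝ) :
    boundary (T.conv φ) = (boundary T).conv φ := by
  ext1 ω
  exact congrArg T (extD_convTest (reflect φ) ω).symm

theorem mass_conv_ne_top {d m : ℕ} (T : Current d m) (hT : mass T ≠ ∞) (φ : Test d ℝ) :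
    mass (T.conv φ) ≠ ∞ := by
  set I : ℝ := (∫ y, ‖reflect φ y‖) + 1 with hI
  have hI0 : 0 < I := add_pos_of_nonneg_of_pos (integral_nonneg fun _ => norm_nonneg _) one_pos
  refine ne_top_of_le_ne_top (ENNReal.mul_ne_top (ENNReal.ofReal_ne_top (r := I)) hT) ?_
  refine iSup₂_le fun ω hω => ?_
  have h1 : T.conv φ ω = I * T (I⁻¹ • convTest (reflect φ) _ ω) := by
    rw [map_smul, smul_eq_mul, mul_inv_cancel_left₀ hI0.ne']
    rfl
  rw [h1, ENNReal.ofReal_mul hI0.le]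
  gcongr
  refine le_iSup₂ (f := fun (ω : Form d m) (_ : ∀ x, ‖ω x‖ ≤ 1) => ENNReal.ofReal (T ω))
    (I⁻¹ • convTest (reflect φ) _ ω) fun x => ?_
  have h2 : ‖convTest (reflect φ) _ ω x‖ ≤ I := by
    refine (norm_convFun_le (reflect φ) hω x).trans ?_
    rw [mul_one, hI]
    linarith
  rw [FunLike.coe_smul, Pi.smul_apply, norm_smul, Real.norm_of_nonneg (inv_nonneg.2 hI0.le)]
  exact inv_mul_le_one_of_le₀ h2 hI0.le

theorem conv_mem {d m : ℕ} {T : Current d m} (hT : T ∈ normalCurrents d m univ)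
    (φ : Test d ℝ) : T.conv φ ∈ normalCurrents d m univ := by
  obtain ⟨h1, h2, -⟩ := hT
  refine ⟨(h1.add φ.hasCompactSupport.isCompact).of_isClosed_subset
    Distribution.isClosed_dsupport (spt_conv T h1 φ), ?_, subset_univ _⟩
  rw [normalMass, ENNReal.add_ne_top] at h2 ⊢
  refine ⟨mass_conv_ne_top T h2.1 φ, ?_⟩
  cases m with
  | zero => simp [boundaryMass]
  | succ m =>
    show mass (boundary (T.conv φ)) ≠ ∞
    rw [boundary_conv]
    exact mass_conv_ne_top _ h2.2 φ

/-- The convolution `ω * φ` of a charge over `ℝ^d` with a test function: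
`(ω * φ)(T) = ω(T * φ(-·))`. -/
def Cochain.conv {d m : ℕ} (ω : Cochain d m univ) (φ : Test d ℝ) : Cochain d m univ where
  toFun T := ω ⟨(T : Current d m).conv (reflect φ), conv_mem T.2 (reflect φ)⟩
  map_add' T S := by
    rw [← map_add]
    rfl
  map_smul' c T := by
    rw [RingHom.id_apply, ← map_smul]
    rfl

/-! ### Mollifiers and the Littlewood-Paley pieces -/

/-- The standing assumptions on the mollifier: it is nonnegative and even, has integral one, and
its support lies in the closed unit ball. -/
structure IsMollifier {d : ℕ} (Φ : Test d ℝ) : Prop where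
  nonneg : ∀ x, 0 ≤ Φ x
  even : ∀ x, Φ (-x) = Φ x
  integral_eq_one : ∫ x, Φ x = 1
  tsupport_subset_closedBall : tsupport Φ ⊆ Metric.closedBall 0 1

/-- The rescaled function `Φ_ε(x) = ε^{-d} Φ(ε^{-1} x)`, for `ε = 2^{-n}`. -/
def dyadicScale {d : ℕ} (Φ : Test d ℝ) (n : ℕ) : Test d ℝ where
  toFun x := ((2 : ℝ) ^ n) ^ d * Φ ((2 : ℝ) ^ n • x)
  contDiff' := contDiff_const.mul (Φ.contDiff.comp (contDiff_const_smul _))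
  hasCompactSupport' :=
    (Φ.hasCompactSupport.comp_smul (pow_ne_zero n (two_ne_zero (α := ℝ)))).mul_left
  tsupport_subset' := fun _ _ => trivial

/-- The Littlewood-Paley pieces of a charge over `ℝ^d`: the first one is `ω * Φ_1`, the following
ones are `ω * Φ_{2^{-(n+1)}} - ω * Φ_{2^{-n}}` for `n = 0, 1, 2, …`. -/
def lpPiece {d m : ℕ} (Φ : Test d ℝ) (ω : Cochain d m univ) : ℕ → Cochain d m univ
  | 0 => ω.conv (dyadicScale Φ 0)
  | n + 1 => ω.conv (dyadicScale Φ (n + 1)) - ω.conv (dyadicScale Φ n)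

end FractionalCharge

end

open FractionalCharge Filter Topology
open scoped ENNReal NNReal

/-!
Two mechanisms are at work: a dyadic summation, and two opposite estimates for the mollification of
normal currents.

*Summation.* Write `N` and `F` for the normal mass and the flat norm of a current `T`, so that
`F ≤ N`. The hypotheses give `|ω_n(T)| ≤ C min (2^{n(1-α)} F, 2^{-nα} N)`. The two bounds balance at
the scale `2^n ≈ N / F`, and both geometric series, below and above that scale, are of the order of
`C N^{1-α} F^α` (`sum_range_le_of_dyadic_bounds`). Hence `∑ ω_n` converges pointwise, the partial
sums and the sum are `α`-fractional with the constant `dyadicConst α * C`, and the tails tend to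
zero in the charge norm because `∑ 2^{-nα}` converges (`weakStarTendsto_sumCochain`). Over the whole
space the pointwise sum is defined current by current, and its restrictions are the sums over compact sets
(`exists_globalWeakStarTendsto_sum`).

*Mollification.* For `T_n = T * Φ_{2^{-n}}` three facts are needed.

* Averaging with a probability density increases neither `N` nor `F`.
* `N(T_n) ≤ A 2^n F(T)`: the derivative in `d (Φ_{2^{-n}} * η)` is put on the kernel
  (`nMass_mollify_le_fNorm`).
* `F(T - T_n) ≤ 2^{-n} N(T)` (`fNorm_thicken_sub_mollify_le`). For a constant vector field `y`,
  Cartan's formula `D_y η = y ⌟ dη + d (y ⌟ η)` gives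
  `|T(D_y η)| ≤ |y| (M(T) ‖dη‖_∞ + M(∂T) ‖η‖_∞)`; integrating along the segment from `0` to `y`
  bounds the difference of `T` and its translate, and averaging over `y` against `Φ_{2^{-n}}` gives
  the claim. The exchange of `T` with these integrals is legitimate because a current of finite mass
  extends to a continuous functional on bounded continuous forms with the supremum norm, where the
  integrals are Bochner integrals (`exists_extension_boundedContinuous`).

With `|ω(S)| ≤ C N(S)^{1-α} F(S)^α` on the unit neighbourhood of `K`, the second fact shows that
`ω * Φ_{2^{-n}}` is bounded by `2^{n(1-α)} F` and the third one that `ω * Φ_{2^{-n}} - ω` is bounded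
by `2^{-nα} N`, which yields the hypotheses of the summation for the Littlewood-Paley pieces. Their
partial sums telescope to `ω * Φ_{2^{-p}}`, which converges to `ω` by the same estimate.
-/

open FractionalCharge Filter Topology
open scoped ENNReal NNReal

namespace FractionalCharge

/-! ### A dyadic summation estimate -/

/-- The constant `2^{1-α} / (2^{1-α} - 1) + 1 / (1 - 2^{-α})`, the sum of the two geometric series
below and above the threshold scale. -/
noncomputable def dyadicConst (α : ℝ) : ℝ :=
  (2 : ℝ) ^ (1 - α) / ((2 : ℝ) ^ (1 - α) - 1) + 1 / (1 - (2 : ℝ) ^ (-α))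

theorem one_lt_two_rpow {α : ℝ} (hα1 : α < 1) : 1 < (2 : ℝ) ^ (1 - α) :=
  Real.one_lt_rpow one_lt_two (by linarith)

theorem two_rpow_neg_lt_one {α : ℝ} (hα0 : 0 < α) : (2 : ℝ) ^ (-α) < 1 :=
  Real.rpow_lt_one_of_one_lt_of_neg one_lt_two (by linarith)

theorem dyadicConst_nonneg {α : ℝ} (hα0 : 0 < α) (hα1 : α < 1) : 0 ≤ dyadicConst α := by
  have h1 := one_lt_two_rpow hα1
  have h2 := two_rpow_neg_lt_one hα0
  exact add_nonneg (div_nonneg (by positivity) (by linarith)) (div_nonneg one_pos.le (by linarith))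

/-- If `a n` is at most `C 2^{n(1-α)} F` and at most `C 2^{-nα} N`, the sum of `a` is at most a
multiple of `C N^{1-α} F^α`: the first bound is used at the scales with `2^n ≤ N / F`, the second
one at the other scales. -/
theorem sum_range_le_of_dyadic_bounds {α : ℝ} (hα0 : 0 < α) (hα1 : α < 1) {C F N : ℝ}
    (hC : 0 ≤ C) (hF : 0 ≤ F) (hFN : F ≤ N) {a : ℕ → ℝ} (ha : ∀ n, 0 ≤ a n)
    (h1 : ∀ n : ℕ, a n ≤ C * (2 : ℝ) ^ ((n : ℝ) * (1 - α)) * F)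
    (h2 : ∀ n : ℕ, a n ≤ C / (2 : ℝ) ^ ((n : ℝ) * α) * N) (p : ℕ) :
    ∑ n ∈ Finset.range p, a n ≤ dyadicConst α * C * N ^ (1 - α) * F ^ α := by
  have hc := dyadicConst_nonneg hα0 hα1
  have hN : 0 ≤ N := hF.trans hFN
  rcases hF.eq_or_lt with rfl | hF
  · have h0 : ∀ n, a n = 0 := fun n => le_antisymm (by simpa using h1 n) (ha n)
    simp only [h0, Finset.sum_const_zero]
    positivity
  have hN : 0 < N := hF.trans_le hFN
  set q : ℝ := (2 : ℝ) ^ (1 - α) with hq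
  set r : ℝ := (2 : ℝ) ^ (-α) with hr
  have hq1 : 1 < q := one_lt_two_rpow hα1
  have hr1 : r < 1 := two_rpow_neg_lt_one hα0
  have hr0 : 0 < r := by positivity
  have hqn : ∀ n : ℕ, (2 : ℝ) ^ ((n : ℝ) * (1 - α)) = q ^ n := fun n => by
    rw [mul_comm, Real.rpow_mul zero_le_two, Real.rpow_natCast]
  have hrn : ∀ n : ℕ, ((2 : ℝ) ^ ((n : ℝ) * α))⁻¹ = r ^ n := fun n => by
    rw [← Real.rpow_neg zero_le_two, ← mul_neg, mul_comm, Real.rpow_mul zero_le_two,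
      Real.rpow_natCast]
  obtain ⟨k, hk1, hk2⟩ := exists_nat_pow_near ((one_le_div hF).2 hFN) (one_lt_two (α := ℝ))
  set X : ℝ := N ^ (1 - α) * F ^ α with hX
  have hqk : F * q ^ k ≤ X := by
    have : q ^ k ≤ (N / F) ^ (1 - α) := by
      rw [hq, ← Real.rpow_natCast, ← Real.rpow_mul zero_le_two, mul_comm,
        Real.rpow_mul zero_le_two, Real.rpow_natCast]
      exact Real.rpow_le_rpow (by positivity) hk1 (by linarith)
    calc F * q ^ k ≤ F * (N / F) ^ (1 - α) := by gcongr
      _ = X := by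
        rw [Real.div_rpow hN.le hF.le, hX, Real.rpow_sub hF, Real.rpow_one]
        field_simp
  have hrk : N * r ^ (k + 1) ≤ X := by
    have : r ^ (k + 1) ≤ (N / F) ^ (-α) := by
      rw [hr, ← Real.rpow_natCast, ← Real.rpow_mul zero_le_two, mul_comm,
        Real.rpow_mul zero_le_two, Real.rpow_natCast]
      exact Real.rpow_le_rpow_of_nonpos (by positivity) hk2.le (by linarith)
    calc N * r ^ (k + 1) ≤ N * (N / F) ^ (-α) := by gcongr
      _ = X := by
        rw [Real.div_rpow hN.le hF.le, hX, Real.rpow_sub hN, Real.rpow_one, Real.rpow_neg hN.le,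
          Real.rpow_neg hF.le]
        field_simp
  have hlow : ∑ n ∈ Finset.range (k + 1), a n ≤ C * X * (q / (q - 1)) := by
    calc ∑ n ∈ Finset.range (k + 1), a n ≤ ∑ n ∈ Finset.range (k + 1), C * F * q ^ n :=
          Finset.sum_le_sum fun n _ => (h1 n).trans_eq (by rw [hqn]; ring)
      _ = C * F * ((q ^ (k + 1) - 1) / (q - 1)) := by rw [← Finset.mul_sum, geom_sum_eq hq1.ne']
      _ ≤ C * F * (q ^ (k + 1) / (q - 1)) := by
        have : 0 < q - 1 := by linarith
        gcongr
        linarith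
      _ = C * (F * q ^ k) * (q / (q - 1)) := by rw [pow_succ]; ring
      _ ≤ C * X * (q / (q - 1)) := by
        have : 0 < q - 1 := by linarith
        gcongr
  have hhigh : ∑ n ∈ Finset.range p, a (k + 1 + n) ≤ C * X * (1 / (1 - r)) := by
    calc ∑ n ∈ Finset.range p, a (k + 1 + n)
        ≤ ∑ n ∈ Finset.range p, C * (N * r ^ (k + 1)) * r ^ n :=
          Finset.sum_le_sum fun n _ => (h2 _).trans_eq (by
            rw [div_eq_mul_inv, hrn, pow_add]; ring)
      _ ≤ C * (N * r ^ (k + 1)) * (1 / (1 - r)) := by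
        rw [← Finset.mul_sum, one_div]
        gcongr
        rw [← tsum_geometric_of_lt_one hr0.le hr1]
        exact (summable_geometric_of_lt_one hr0.le hr1).sum_le_tsum _ fun n _ => by positivity
      _ ≤ C * X * (1 / (1 - r)) := by
        have : 0 < 1 - r := by linarith
        gcongr
  calc ∑ n ∈ Finset.range p, a n ≤ ∑ n ∈ Finset.range (k + 1 + p), a n :=
        Finset.sum_le_sum_of_subset_of_nonneg (Finset.range_mono (by omega)) fun n _ _ => ha n
    _ = ∑ n ∈ Finset.range (k + 1), a n + ∑ n ∈ Finset.range p, a (k + 1 + n) :=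
        Finset.sum_range_add _ _ _
    _ ≤ C * X * (q / (q - 1)) + C * X * (1 / (1 - r)) := add_le_add hlow hhigh
    _ = dyadicConst α * C * N ^ (1 - α) * F ^ α := by rw [dyadicConst, hX]; ring

/-! ### Mass and flat norm -/

variable {d m : ℕ} {X : Set (Euc d)}

theorem ofReal_le_mass (T : Current d m) {η : Form d m} (hη : ∀ x, ‖η x‖ ≤ 1) :
    ENNReal.ofReal (T η) ≤ mass T :=
  le_iSup₂ (f := fun (η : Form d m) (_ : ∀ x, ‖η x‖ ≤ 1) => ENNReal.ofReal (T η)) η hη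

theorem flatNorm_le_mass (T : Current d m) : flatNorm T ≤ mass T :=
  iSup₂_le fun _ hη => ofReal_le_mass T hη.1

theorem flatNorm_ne_top {T : Current d m} (hT : mass T ≠ ∞) : flatNorm T ≠ ∞ :=
  ne_top_of_le_ne_top hT (flatNorm_le_mass T)

/-- Homogeneity: if `T` is at most `M` on the forms satisfying the normalization `p`, and `c • η`
satisfies it whenever `c B ≤ 1`, then `T η ≤ M B`. For `B = 0` all the positive multiples of `η` are
normalized, which forces `T η ≤ 0`. -/
theorem apply_le_mul_of_forall_smul {T : Current d m} {M : ℝ} {p : Form d m → Prop} {η : Form d m}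
    {B : ℝ} (hB : 0 ≤ B) (hM : ∀ ζ, p ζ → T ζ ≤ M) (hp : ∀ c : ℝ, 0 ≤ c → c * B ≤ 1 → p (c • η)) :
    T η ≤ M * B := by
  rcases hB.eq_or_lt with rfl | hB
  · by_contra! h
    rw [mul_zero] at h
    have h1 := hM _ (hp ((|M| + 1) / T η) (by positivity) (by simp))
    rw [map_smul, smul_eq_mul, div_mul_cancel₀ _ h.ne'] at h1
    linarith [le_abs_self M]
  · have h1 := hM _ (hp B⁻¹ (by positivity) (inv_mul_cancel₀ hB.ne').le)
    rw [map_smul, smul_eq_mul, inv_mul_le_iff₀ hB] at h1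
    linarith

theorem apply_le_mass {T : Current d m} (hT : mass T ≠ ∞) {η : Form d m} {B : ℝ} (hB : 0 ≤ B)
    (hη : ∀ x, ‖η x‖ ≤ B) : T η ≤ (mass T).toReal * B := by
  refine apply_le_mul_of_forall_smul (p := fun ζ => ∀ x, ‖ζ x‖ ≤ 1) hB
    (fun ζ hζ => (ENNReal.ofReal_le_iff_le_toReal hT).1 (ofReal_le_mass T hζ))
    fun c hc hcB x => ?_
  rw [FunLike.coe_smul, Pi.smul_apply, norm_smul, Real.norm_of_nonneg hc]
  exact (mul_le_mul_of_nonneg_left (hη x) hc).trans hcB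

theorem abs_apply_le_mass {T : Current d m} (hT : mass T ≠ ∞) {η : Form d m} {B : ℝ} (hB : 0 ≤ B)
    (hη : ∀ x, ‖η x‖ ≤ B) : |T η| ≤ (mass T).toReal * B := by
  refine abs_le'.2 ⟨apply_le_mass hT hB hη, ?_⟩
  rw [← map_neg]
  exact apply_le_mass hT hB fun x => by simpa using hη x

theorem mass_toReal_le {T : Current d m} {c : ℝ} (hc : 0 ≤ c)
    (h : ∀ η : Form d m, (∀ x, ‖η x‖ ≤ 1) → T η ≤ c) : (mass T).toReal ≤ c :=
  ENNReal.toReal_le_of_le_ofReal hc (iSup₂_le fun η hη => ENNReal.ofReal_le_ofReal (h η hη))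

theorem extDeriv_smul_apply (c : ℝ) (η : Form d m) (x : Euc d) :
    extDeriv (c • η : Form d m) x = c • extDeriv η x := by
  rw [← extD_apply, ← extD_apply, map_smul]
  rfl

theorem apply_le_flatNorm {T : Current d m} (hT : flatNorm T ≠ ∞) {η : Form d m} {B : ℝ}
    (hB : 0 ≤ B) (hη : ∀ x, ‖η x‖ ≤ B) (hdη : ∀ x, ‖extDeriv η x‖ ≤ B) :
    T η ≤ (flatNorm T).toReal * B := by
  refine apply_le_mul_of_forall_smul
    (p := fun ζ => (∀ x, ‖ζ x‖ ≤ 1) ∧ ∀ x, ‖extDeriv ζ x‖ ≤ 1) hB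
    (fun ζ hζ => (ENNReal.ofReal_le_iff_le_toReal hT).1
      (le_iSup₂ (f := fun (ζ : Form d m) (_ : (∀ x, ‖ζ x‖ ≤ 1) ∧ ∀ x, ‖extDeriv ζ x‖ ≤ 1) =>
        ENNReal.ofReal (T ζ)) ζ hζ))
    fun c hc hcB => ⟨fun x => ?_, fun x => ?_⟩
  · rw [FunLike.coe_smul, Pi.smul_apply, norm_smul, Real.norm_of_nonneg hc]
    exact (mul_le_mul_of_nonneg_left (hη x) hc).trans hcB
  · rw [extDeriv_smul_apply, norm_smul, Real.norm_of_nonneg hc]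
    exact (mul_le_mul_of_nonneg_left (hdη x) hc).trans hcB

theorem flatNorm_toReal_le {T : Current d m} {c : ℝ} (hc : 0 ≤ c)
    (h : ∀ η : Form d m, (∀ x, ‖η x‖ ≤ 1) → (∀ x, ‖extDeriv η x‖ ≤ 1) → T η ≤ c) :
    (flatNorm T).toReal ≤ c :=
  ENNReal.toReal_le_of_le_ofReal hc
    (iSup₂_le fun η hη => ENNReal.ofReal_le_ofReal (h η hη.1 hη.2))

theorem mass_ne_top (T : normalCurrents d m X) : mass (T : Current d m) ≠ ∞ :=
  (ENNReal.add_ne_top.1 T.2.2.1).1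

theorem boundaryMass_ne_top (T : normalCurrents d m X) : boundaryMass (T : Current d m) ≠ ∞ :=
  (ENNReal.add_ne_top.1 T.2.2.1).2

theorem nMass_eq (T : normalCurrents d m X) :
    nMass T = (mass (T : Current d m)).toReal + (boundaryMass (T : Current d m)).toReal :=
  ENNReal.toReal_add (mass_ne_top T) (boundaryMass_ne_top T)

theorem nMass_nonneg (T : normalCurrents d m X) : 0 ≤ nMass T := ENNReal.toReal_nonneg

theorem fNorm_nonneg (T : normalCurrents d m X) : 0 ≤ fNorm T := ENNReal.toReal_nonneg

theorem fNorm_le_nMass (T : normalCurrents d m X) : fNorm T ≤ nMass T :=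
  ENNReal.toReal_mono T.2.2.1 ((flatNorm_le_mass _).trans le_self_add)

theorem nMass_smul_le (c : ℝ) (T : normalCurrents d m X) : nMass (c • T) ≤ |c| * nMass T := by
  have h : normalMass ((c • T : normalCurrents d m X) : Current d m) ≤
      ENNReal.ofReal |c| * normalMass (T : Current d m) := by
    rw [normalMass, normalMass, mul_add]
    exact add_le_add (mass_smul c _) (boundaryMass_smul c _)
  refine (ENNReal.toReal_mono (ENNReal.mul_ne_top ENNReal.ofReal_ne_top T.2.2.1) h).trans_eq ?_
  rw [ENNReal.toReal_mul, ENNReal.toReal_ofReal (abs_nonneg c)]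
  rfl

theorem nMass_add_le (T S : normalCurrents d m X) : nMass (T + S) ≤ nMass T + nMass S := by
  rw [nMass, nMass, nMass, ← ENNReal.toReal_add T.2.2.1 S.2.2.1]
  refine ENNReal.toReal_mono (ENNReal.add_ne_top.2 ⟨T.2.2.1, S.2.2.1⟩) ?_
  calc normalMass ((T : Current d m) + (S : Current d m))
      ≤ (mass (T : Current d m) + mass (S : Current d m)) +
        (boundaryMass (T : Current d m) + boundaryMass (S : Current d m)) :=
        add_le_add (mass_add _ _) (boundaryMass_add _ _)
    _ = normalMass (T : Current d m) + normalMass (S : Current d m) := by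
      rw [normalMass, normalMass]; ring

theorem sub_eq_add_smul (T S : normalCurrents d m X) : T - S = T + (-1 : ℝ) • S :=
  Subtype.ext (ContinuousLinearMap.ext fun η => by
    change (T : Current d m) η - (S : Current d m) η =
      (T : Current d m) η + (-1 : ℝ) * (S : Current d m) η
    ring)

theorem cochain_sub_apply (ω : Cochain d m X) (T S : normalCurrents d m X) :
    ω (T - S) = ω T - ω S := by
  rw [sub_eq_add_smul, map_add, map_smul, neg_one_smul, sub_eq_add_neg]

theorem nMass_sub_le (T S : normalCurrents d m X) : nMass (T - S) ≤ nMass T + nMass S := by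
  have h : nMass ((-1 : ℝ) • S) ≤ nMass S := by
    simpa only [abs_neg, abs_one, one_mul] using nMass_smul_le (-1) S
  rw [sub_eq_add_smul]
  exact (nMass_add_le T _).trans (by gcongr)

theorem apply_le_fNorm (T : normalCurrents d m X) {η : Form d m} {B : ℝ} (hB : 0 ≤ B)
    (hη : ∀ x, ‖η x‖ ≤ B) (hdη : ∀ x, ‖extDeriv η x‖ ≤ B) :
    (T : Current d m) η ≤ fNorm T * B :=
  apply_le_flatNorm (flatNorm_ne_top (mass_ne_top T)) hB hη hdη

theorem fNorm_le {T : normalCurrents d m X} {c : ℝ} (hc : 0 ≤ c)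
    (h : ∀ η : Form d m, (∀ x, ‖η x‖ ≤ 1) → (∀ x, ‖extDeriv η x‖ ≤ 1) →
      (T : Current d m) η ≤ c) : fNorm T ≤ c :=
  flatNorm_toReal_le hc h

/-! ### Norms of charges -/

/-- The infimum defining the fractional norm is attained. -/
theorem fracBound_of_fracNorm_le {α c : ℝ} (hc : 0 ≤ c) {ω : Cochain d m X}
    (h : fracNorm α ω ≤ ENNReal.ofReal c) : FracBound α c ω := by
  intro T
  have hY : 0 ≤ nMass T ^ (1 - α) * fNorm T ^ α :=
    mul_nonneg (Real.rpow_nonneg (nMass_nonneg T) _) (Real.rpow_nonneg (fNorm_nonneg T) _)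
  set Y := nMass T ^ (1 - α) * fNorm T ^ α
  refine le_of_forall_pos_le_add fun ε hε => ?_
  have h1 : fracNorm α ω < ENNReal.ofReal (c + ε / (Y + 1)) :=
    h.trans_lt ((ENNReal.ofReal_lt_ofReal_iff (by positivity)).2
      (lt_add_of_pos_right c (by positivity)))
  simp only [fracNorm, iInf_lt_iff] at h1
  obtain ⟨C, hC, hlt⟩ := h1
  have hC' : (C : ℝ) ≤ c + ε / (Y + 1) := by
    rw [← ENNReal.ofReal_coe_nnreal] at hlt
    exact ((ENNReal.ofReal_lt_ofReal_iff (by positivity)).1 hlt).le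
  calc |ω T| ≤ C * Y := (hC T).trans_eq (mul_assoc _ _ _)
    _ ≤ (c + ε / (Y + 1)) * Y := by gcongr
    _ = c * Y + ε * (Y / (Y + 1)) := by ring
    _ ≤ c * Y + ε * 1 := by
      gcongr
      exact (div_le_one (by positivity)).2 (by linarith)
    _ = c * nMass T ^ (1 - α) * fNorm T ^ α + ε := by rw [mul_one, ← mul_assoc]

theorem fracNorm_le_of_fracBound {α c : ℝ} (hc : 0 ≤ c) {ω : Cochain d m X}
    (h : FracBound α c ω) : fracNorm α ω ≤ ENNReal.ofReal c := by
  lift c to ℝ≥0 using hc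
  rw [ENNReal.ofReal_coe_nnreal]
  exact iInf₂_le c h

theorem chargeNorm_le {c : ℝ} (hc : 0 ≤ c) {ω : Cochain d m X} (h : ∀ T, |ω T| ≤ c * nMass T) :
    chargeNorm ω ≤ ENNReal.ofReal c := by
  refine iSup₂_le fun T hT => ENNReal.ofReal_le_ofReal ?_
  exact ((le_abs_self _).trans (h T)).trans (mul_le_of_le_one_right hc hT)

theorem abs_apply_le_of_chargeNorm_le {c : ℝ} (hc : 0 ≤ c) {ω : Cochain d m X}
    (h : chargeNorm ω ≤ ENNReal.ofReal c) (T : normalCurrents d m X) : |ω T| ≤ c * nMass T := by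
  have key : ∀ S : normalCurrents d m X, nMass S ≤ 1 → ω S ≤ c := fun S hS =>
    (ENNReal.ofReal_le_ofReal_iff hc).1 ((le_iSup₂ (f := fun (T : normalCurrents d m X)
      (_ : nMass T ≤ 1) => ENNReal.ofReal (ω T)) S hS).trans h)
  have main : ∀ S : normalCurrents d m X, ω S ≤ c * nMass S := fun S => by
    rcases (nMass_nonneg S).eq_or_lt with h0 | h0
    · -- every multiple of `S` has normal mass zero, which forces `ω S ≤ 0`
      rw [← h0, mul_zero]
      by_contra! hS
      have h1 := key (((c + 1) / ω S) • S)
        ((nMass_smul_le _ S).trans (by rw [← h0, mul_zero]; exact zero_le_one))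
      rw [map_smul, smul_eq_mul, div_mul_cancel₀ _ hS.ne'] at h1
      linarith
    · have h1 := key ((nMass S)⁻¹ • S) ((nMass_smul_le _ S).trans (by
        rw [abs_of_pos (inv_pos.2 h0), inv_mul_cancel₀ h0.ne']))
      rw [map_smul, smul_eq_mul, inv_mul_le_iff₀ h0] at h1
      linarith
  refine abs_le'.2 ⟨main T, ?_⟩
  have h1 := main ((-1 : ℝ) • T)
  rw [map_smul, neg_one_smul] at h1
  exact h1.trans (mul_le_mul_of_nonneg_left
    (by simpa only [abs_neg, abs_one, one_mul] using nMass_smul_le (-1) T) hc)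

theorem FracBound.abs_apply_le_nMass {α c : ℝ} (hα0 : 0 < α) (hc : 0 ≤ c)
    {ω : Cochain d m X} (h : FracBound α c ω) (T : normalCurrents d m X) :
    |ω T| ≤ c * nMass T := by
  refine (h T).trans ?_
  rw [mul_assoc]
  refine mul_le_mul_of_nonneg_left ?_ hc
  rcases (nMass_nonneg T).eq_or_lt with h0 | h0
  · have : fNorm T = 0 := le_antisymm ((fNorm_le_nMass T).trans h0.ge) (fNorm_nonneg T)
    rw [this, Real.zero_rpow hα0.ne', mul_zero]
    exact h0.le
  · calc nMass T ^ (1 - α) * fNorm T ^ α ≤ nMass T ^ (1 - α) * nMass T ^ α := by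
          gcongr
          · exact fNorm_nonneg T
          · exact fNorm_le_nMass T
      _ = nMass T := by rw [← Real.rpow_add h0, sub_add_cancel, Real.rpow_one]

/-- A fractional charge is a charge, by Young's inequality. -/
theorem IsFractionalCharge.isCharge {α : ℝ} (hα0 : 0 < α) {ω : Cochain d m X}
    (h : IsFractionalCharge α ω) : IsCharge ω := by
  obtain ⟨C, hC, hω⟩ := h
  intro ε hε
  -- at the threshold `F = δ N` with `C δ^α = ε`, the first or the second term dominates
  set δ : ℝ := (ε / (C + 1)) ^ α⁻¹ with hδ
  have hδ0 : 0 < δ := by positivity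
  have hδα : δ ^ α = ε / (C + 1) := by
    rw [hδ, ← Real.rpow_mul (by positivity), inv_mul_cancel₀ hα0.ne', Real.rpow_one]
  refine ⟨C / δ, by positivity, fun T => ?_⟩
  have hN := nMass_nonneg T
  have hF := fNorm_nonneg T
  rcases le_total (fNorm T) (δ * nMass T) with hle | hle
  · have h1 : |ω T| ≤ ε * nMass T := by
      rcases hN.eq_or_lt with h0 | h0
      · have := hω.abs_apply_le_nMass hα0 hC T
        rw [← h0] at this ⊢
        simpa using this
      calc |ω T| ≤ C * nMass T ^ (1 - α) * fNorm T ^ α := hω T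
        _ ≤ C * nMass T ^ (1 - α) * (δ * nMass T) ^ α := by gcongr
        _ = C * (ε / (C + 1)) * (nMass T ^ (1 - α) * nMass T ^ α) := by
          rw [Real.mul_rpow hδ0.le hN, hδα]; ring
        _ = ε * nMass T * (C / (C + 1)) := by
          rw [← Real.rpow_add h0, sub_add_cancel, Real.rpow_one]; ring
        _ ≤ ε * nMass T * 1 := by
          gcongr
          exact (div_le_one (by positivity)).2 (by linarith)
        _ = ε * nMass T := mul_one _
    have : 0 ≤ C / δ * fNorm T := by positivity
    linarith
  · have h1 : |ω T| ≤ C / δ * fNorm T := by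
      refine (hω.abs_apply_le_nMass hα0 hC T).trans ?_
      rw [div_mul_eq_mul_div, le_div_iff₀ hδ0, mul_assoc, mul_comm (nMass T)]
      gcongr
    have : 0 ≤ ε * nMass T := by positivity
    linarith

/-! ### Sums of charges under dyadic bounds -/

/-- The pointwise sum of a sequence of linear functionals. -/
noncomputable def sumCochain (ω : ℕ → Cochain d m X) (h : ∀ T, Summable fun n => ω n T) :
    Cochain d m X where
  toFun T := ∑' n, ω n T
  map_add' T S := by simp only [map_add, (h T).tsum_add (h S)]
  map_smul' c T := by simp only [map_smul, smul_eq_mul, tsum_mul_left, RingHom.id_apply]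

theorem sumCochain_apply (ω : ℕ → Cochain d m X) (h : ∀ T, Summable fun n => ω n T)
    (T : normalCurrents d m X) : sumCochain ω h T = ∑' n, ω n T := rfl

theorem summable_dyadic {α : ℝ} (hα0 : 0 < α) (C : ℝ) :
    Summable fun n : ℕ => C / (2 : ℝ) ^ ((n : ℝ) * α) := by
  have h : (fun n : ℕ => C / (2 : ℝ) ^ ((n : ℝ) * α)) = fun n : ℕ => C * ((2 : ℝ) ^ (-α)) ^ n := by
    funext n
    rw [div_eq_mul_inv, ← Real.rpow_neg zero_le_two, ← mul_neg, mul_comm (n : ℝ),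
      Real.rpow_mul zero_le_two, Real.rpow_natCast]
  rw [h]
  exact (summable_geometric_of_lt_one (by positivity) (two_rpow_neg_lt_one hα0)).mul_left C

theorem summable_apply_of_chargeNorm_le {α C : ℝ} (hα0 : 0 < α) (hC : 0 ≤ C)
    {ω : ℕ → Cochain d m X}
    (h : ∀ n : ℕ, chargeNorm (ω n) ≤ ENNReal.ofReal (C / (2 : ℝ) ^ ((n : ℝ) * α)))
    (T : normalCurrents d m X) : Summable fun n => ω n T :=
  Summable.of_norm_bounded ((summable_dyadic hα0 C).mul_right (nMass T)) fun n =>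
    abs_apply_le_of_chargeNorm_le (by positivity) (h n) T

theorem sum_fracBound {α C : ℝ} (hα0 : 0 < α) (hα1 : α < 1) (hC : 0 ≤ C) {ω : ℕ → Cochain d m X}
    (h1 : ∀ n : ℕ, fracNorm 1 (ω n) ≤ ENNReal.ofReal (C * (2 : ℝ) ^ ((n : ℝ) * (1 - α))))
    (h2 : ∀ n : ℕ, chargeNorm (ω n) ≤ ENNReal.ofReal (C / (2 : ℝ) ^ ((n : ℝ) * α)))
    (T : normalCurrents d m X) (p : ℕ) :
    ∑ n ∈ Finset.range p, |ω n T| ≤ dyadicConst α * C * nMass T ^ (1 - α) * fNorm T ^ α :=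
  sum_range_le_of_dyadic_bounds hα0 hα1 hC (fNorm_nonneg T) (fNorm_le_nMass T)
    (fun _ => abs_nonneg _)
    (fun n => by simpa using fracBound_of_fracNorm_le (by positivity) (h1 n) T)
    (fun n => abs_apply_le_of_chargeNorm_le (by positivity) (h2 n) T) p

theorem sumCochain_fracBound {α C : ℝ} (hα0 : 0 < α) (hα1 : α < 1) (hC : 0 ≤ C)
    {ω : ℕ → Cochain d m X}
    (h1 : ∀ n : ℕ, fracNorm 1 (ω n) ≤ ENNReal.ofReal (C * (2 : ℝ) ^ ((n : ℝ) * (1 - α))))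
    (h2 : ∀ n : ℕ, chargeNorm (ω n) ≤ ENNReal.ofReal (C / (2 : ℝ) ^ ((n : ℝ) * α)))
    (h : ∀ T, Summable fun n => ω n T) : FracBound α (dyadicConst α * C) (sumCochain ω h) := by
  intro T
  refine le_of_tendsto ((h T).hasSum.tendsto_sum_nat.abs) (Eventually.of_forall fun p => ?_)
  exact (Finset.abs_sum_le_sum_abs _ _).trans (sum_fracBound hα0 hα1 hC h1 h2 T p)

theorem weakStarTendsto_sumCochain {α C : ℝ} (hα0 : 0 < α) (hα1 : α < 1) (hC : 0 ≤ C)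
    {ω : ℕ → Cochain d m X}
    (h1 : ∀ n : ℕ, fracNorm 1 (ω n) ≤ ENNReal.ofReal (C * (2 : ℝ) ^ ((n : ℝ) * (1 - α))))
    (h2 : ∀ n : ℕ, chargeNorm (ω n) ≤ ENNReal.ofReal (C / (2 : ℝ) ^ ((n : ℝ) * α)))
    (h : ∀ T, Summable fun n => ω n T) :
    WeakStarTendsto α (fun p => ∑ n ∈ Finset.range p, ω n) (sumCochain ω h) := by
  have hc : 0 ≤ dyadicConst α * C := mul_nonneg (dyadicConst_nonneg hα0 hα1) hC
  have hb : ∀ p, FracBound α (dyadicConst α * C) (∑ n ∈ Finset.range p, ω n) := fun p T => by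
    rw [LinearMap.sum_apply]
    exact (Finset.abs_sum_le_sum_abs _ _).trans (sum_fracBound hα0 hα1 hC h1 h2 T p)
  refine ⟨fun p => ⟨_, hc, hb p⟩, ⟨_, hc, sumCochain_fracBound hα0 hα1 hC h1 h2 h⟩,
    ⟨(dyadicConst α * C).toNNReal, fun p => fracNorm_le_of_fracBound hc (hb p)⟩, ?_⟩
  -- the tails of the sum are controlled by the tails of the geometric series `∑ C 2^{-nα}`
  set b : ℕ → ℝ := fun n => C / (2 : ℝ) ^ ((n : ℝ) * α) with hbdef
  have hbs : Summable b := summable_dyadic hα0 C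
  have hb0 : ∀ n, 0 ≤ b n := fun n => by positivity
  have htail : Tendsto (fun p => ENNReal.ofReal (∑' n, b (n + p))) atTop (𝓝 0) := by
    rw [← ENNReal.ofReal_zero]
    exact ENNReal.tendsto_ofReal (tendsto_sum_nat_add b)
  refine tendsto_of_tendsto_of_tendsto_of_le_of_le tendsto_const_nhds htail
    (fun _ => zero_le) fun p => chargeNorm_le (tsum_nonneg fun n => hb0 _) fun T => ?_
  have hsplit := (h T).sum_add_tsum_nat_add p
  have heq : (∑ n ∈ Finset.range p, ω n - sumCochain ω h) T = -∑' n, ω (n + p) T := by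
    rw [LinearMap.sub_apply, LinearMap.sum_apply, sumCochain_apply, ← hsplit]
    ring
  rw [heq, abs_neg, ← tsum_mul_right, ← Real.norm_eq_abs]
  exact tsum_of_norm_bounded (((summable_nat_add_iff p).2 hbs).mul_right _).hasSum fun n =>
    abs_apply_le_of_chargeNorm_le (hb0 _) (h2 _) T

/-! ### Charges over the whole space -/

theorem restrictCharge_sum (K : Set (Euc d)) (ω : ℕ → Cochain d m univ) (s : Finset ℕ) :
    restrictCharge K (∑ n ∈ s, ω n) = ∑ n ∈ s, restrictCharge K (ω n) := by
  ext T
  simp [restrictCharge]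

theorem restrictCharge_sub (K : Set (Euc d)) (ω ω' : Cochain d m univ) :
    restrictCharge K (ω - ω') = restrictCharge K ω - restrictCharge K ω' := rfl

/-- A normal current over `ℝ^d`, as a normal current over its support. -/
def toSpt (T : normalCurrents d m univ) : normalCurrents d m (spt (T : Current d m)) :=
  ⟨T, T.2.1, T.2.2.1, Subset.rfl⟩

theorem isGlobalFractionalCharge_of_forall {α : ℝ} (hα0 : 0 < α)
    {ω : Cochain d m univ} (h : ∀ K, IsCompact K → IsFractionalCharge α (restrictCharge K ω)) :
    IsGlobalFractionalCharge α ω :=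
  ⟨fun K hK => (h K hK).isCharge hα0, h⟩

theorem globalWeakStarTendsto_of_forall {α : ℝ} (hα0 : 0 < α)
    {u : ℕ → Cochain d m univ} {ω : Cochain d m univ}
    (h : ∀ K, IsCompact K →
      WeakStarTendsto α (fun p => restrictCharge K (u p)) (restrictCharge K ω)) :
    GlobalWeakStarTendsto α u ω :=
  ⟨fun n => isGlobalFractionalCharge_of_forall hα0 fun K hK => (h K hK).1 n,
    isGlobalFractionalCharge_of_forall hα0 fun K hK => (h K hK).2.1,
    fun K hK => (h K hK).2.2.1, fun K hK => (h K hK).2.2.2⟩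

theorem exists_globalWeakStarTendsto_sum {α : ℝ} (hα0 : 0 < α) (hα1 : α < 1)
    {ω : ℕ → Cochain d m univ} {C : Set (Euc d) → ℝ} (hC : ∀ K, IsCompact K → 0 ≤ C K)
    (h1 : ∀ K, IsCompact K → ∀ n : ℕ, fracNorm 1 (restrictCharge K (ω n)) ≤
      ENNReal.ofReal (C K * (2 : ℝ) ^ ((n : ℝ) * (1 - α))))
    (h2 : ∀ K, IsCompact K → ∀ n : ℕ, chargeNorm (restrictCharge K (ω n)) ≤
      ENNReal.ofReal (C K / (2 : ℝ) ^ ((n : ℝ) * α))) :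
    ∃ ω' : Cochain d m univ,
      GlobalWeakStarTendsto α (fun p => ∑ n ∈ Finset.range p, ω n) ω' ∧
      ∀ K, IsCompact K → fracNorm α (restrictCharge K ω') ≤
        ENNReal.ofReal (dyadicConst α * C K) := by
  have hs : ∀ T, Summable fun n => ω n T := fun T =>
    summable_apply_of_chargeNorm_le hα0 (hC _ T.2.1) (h2 _ T.2.1) (toSpt T)
  have hsK : ∀ K T, Summable fun n => restrictCharge K (ω n) T := fun K T => hs _
  have hr : ∀ K, restrictCharge K (sumCochain ω hs) =
      sumCochain (fun n => restrictCharge K (ω n)) (hsK K) := fun K => rfl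
  refine ⟨sumCochain ω hs, globalWeakStarTendsto_of_forall hα0 fun K hK => ?_,
    fun K hK => ?_⟩
  · simp only [restrictCharge_sum, hr]
    exact weakStarTendsto_sumCochain hα0 hα1 (hC K hK) (h1 K hK) (h2 K hK) _
  · rw [hr]
    exact fracNorm_le_of_fracBound (mul_nonneg (dyadicConst_nonneg hα0 hα1) (hC K hK))
      (sumCochain_fracBound hα0 hα1 (hC K hK) (h1 K hK) (h2 K hK) _)

/-! ### Translations and directional derivatives of test functions -/

section Translate

variable {F : Type} [NormedAddCommGroup F] [NormedSpace ℝ F]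

/-- The translate `x ↦ f (x - y)` of a test function. -/
noncomputable def translate (y : Euc d) (f : Test d F) : Test d F where
  toFun x := f (x - y)
  contDiff' := f.contDiff.comp (contDiff_id.sub contDiff_const)
  hasCompactSupport' := f.hasCompactSupport.comp_homeomorph (Homeomorph.subRight y)
  tsupport_subset' := fun _ _ => trivial

theorem translate_apply (y : Euc d) (f : Test d F) (x : Euc d) : translate y f x = f (x - y) := rfl

/-- The directional derivative `x ↦ D f (x) y` of a test function. -/
noncomputable def dirDeriv (y : Euc d) (f : Test d F) : Test d F :=
  TestFunction.postcompCLM (ContinuousLinearMap.apply ℝ F y) (TestFunction.fderivCLM ℝ ⊤ ⊤ f)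

theorem dirDeriv_apply (y : Euc d) (f : Test d F) (x : Euc d) :
    dirDeriv y f x = fderiv ℝ f x y := by
  simp [dirDeriv]

theorem fderiv_translate (y : Euc d) (f : Test d F) (x : Euc d) :
    fderiv ℝ (translate y f) x = fderiv ℝ f (x - y) :=
  fderiv_comp_sub (f := f) y

theorem dirDeriv_translate (w y : Euc d) (f : Test d F) :
    dirDeriv y (translate w f) = translate w (dirDeriv y f) := by
  ext1 x
  rw [translate_apply, dirDeriv_apply, dirDeriv_apply, fderiv_translate]

/-- A test function as a bounded continuous function. -/
noncomputable def toBCF (F : Type) [NormedAddCommGroup F] [NormedSpace ℝ F] :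
    Test d F →ₗ[ℝ] BoundedContinuousFunction (Euc d) F where
  toFun f := (f : BoundedContinuousFunction (Euc d) F)
  map_add' _ _ := rfl
  map_smul' _ _ := rfl

theorem toBCF_apply (f : Test d F) (x : Euc d) : toBCF F f x = f x := rfl

/-- Translation is continuous for the supremum norm, by uniform continuity. -/
theorem continuous_toBCF_translate (f : Test d F) :
    Continuous fun y => toBCF F (translate y f) := by
  have hu := f.hasCompactSupport.uniformContinuous_of_continuous f.continuous
  refine Metric.continuous_iff.2 fun y ε hε => ?_
  obtain ⟨δ, hδ, h⟩ := Metric.uniformContinuous_iff.1 hu (ε / 2) (half_pos hε)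
  refine ⟨δ, hδ, fun z hz => ?_⟩
  refine ((BoundedContinuousFunction.dist_le (half_pos hε).le).2 fun x => ?_).trans_lt
    (half_lt_self hε)
  refine (h ?_).le
  rwa [dist_sub_left]

theorem integral_toBCF_dirDeriv [CompleteSpace F] (y : Euc d) (f : Test d F) :
    ∫ t in (0 : ℝ)..1, toBCF F (translate (t • y) (dirDeriv y f)) =
      toBCF F f - toBCF F (translate y f) := by
  have hc : Continuous fun t : ℝ => toBCF F (translate (t • y) (dirDeriv y f)) :=
    (continuous_toBCF_translate _).comp (continuous_id.smul continuous_const)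
  ext1 x
  have h1 := (BoundedContinuousFunction.evalCLM ℝ (β := F) x).intervalIntegral_comp_comm
    (hc.intervalIntegrable (μ := volume) 0 1)
  have hd : ∀ t : ℝ, HasDerivAt (fun t : ℝ => -f (x - t • y)) (dirDeriv y f (x - t • y)) t := by
    intro t
    have h2 : HasDerivAt (fun t : ℝ => x - t • y) (-y) t := by
      simpa using ((hasDerivAt_id t).smul_const y).const_sub x
    have h3 := ((f.contDiff.differentiable (by simp) (x - t • y)).hasFDerivAt.comp_hasDerivAt
      t h2).neg
    rw [map_neg, neg_neg] at h3
    rw [dirDeriv_apply]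
    exact h3
  have h4 := intervalIntegral.integral_eq_sub_of_hasDerivAt (fun t _ => hd t)
    (Continuous.intervalIntegrable (by fun_prop) 0 1)
  refine h1.symm.trans (h4.trans ?_)
  simp [toBCF_apply, translate_apply]
  abel

theorem toBCF_convTest [CompleteSpace F] (φ : Test d ℝ) (f : Test d F) :
    Integrable (fun y => φ y • toBCF F (translate y f)) ∧
      toBCF F (convTest φ F f) = ∫ y, φ y • toBCF F (translate y f) := by
  have hi : Integrable (fun y => φ y • toBCF F (translate y f)) :=
    Continuous.integrable_of_hasCompactSupport
      (φ.continuous.smul (continuous_toBCF_translate f)) φ.hasCompactSupport.smul_right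
  refine ⟨hi, ?_⟩
  ext1 x
  exact (BoundedContinuousFunction.evalCLM ℝ (β := F) x).integral_comp_comm hi

end Translate

/-! ### Currents of finite mass and averages of translates -/

/-- A current of finite mass is bounded for the supremum norm, so that it extends to bounded
continuous forms by the Hahn-Banach theorem. -/
theorem exists_extension_boundedContinuous {T : Current d m} (hT : mass T ≠ ∞) :
    ∃ L : BoundedContinuousFunction (Euc d) (Covector d m) →L[ℝ] ℝ,
      ∀ η : Form d m, L (toBCF _ η) = T η := by
  have hinj : Function.Injective (toBCF (d := d) (Covector d m)) := fun f g h =>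
    TestFunction.ext fun x => by rw [← toBCF_apply, h, toBCF_apply]
  let e := LinearEquiv.ofInjective _ hinj
  let f : (LinearMap.range (toBCF (d := d) (Covector d m))) →ₗ[ℝ] ℝ :=
    (T : Form d m →ₗ[ℝ] ℝ) ∘ₗ (e.symm : _ →ₗ[ℝ] Form d m)
  have he : ∀ u, toBCF _ (e.symm u) = u := fun u =>
    congrArg Subtype.val (e.apply_symm_apply u)
  have hf : ∀ u, ‖f u‖ ≤ (mass T).toReal * ‖u‖ := fun u => by
    refine abs_apply_le_mass hT (norm_nonneg u) fun x => ?_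
    have h1 := (toBCF _ (e.symm u)).norm_coe_le_norm x
    rw [he u] at h1
    have h2 : toBCF _ (e.symm u) x = (u : BoundedContinuousFunction (Euc d) _) x := by rw [he u]
    exact (congrArg norm h2).trans_le h1
  obtain ⟨L, hL, -⟩ := exists_extension_norm_eq _ (f.mkContinuous _ hf)
  refine ⟨L, fun η => ?_⟩
  have h1 := hL (e η)
  have h2 : f (e η) = T η := congrArg T (e.symm_apply_apply η)
  exact h1.trans h2

/-- Evaluation of a current of finite mass commutes with the average over translations. -/
theorem apply_convTest_eq_integral {T : Current d m} (hT : mass T ≠ ∞) (φ : Test d ℝ)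
    (η : Form d m) :
    Integrable (fun y => φ y * T (translate y η)) ∧
      T (convTest φ _ η) = ∫ y, φ y * T (translate y η) := by
  obtain ⟨L, hL⟩ := exists_extension_boundedContinuous hT
  obtain ⟨hi, h⟩ := toBCF_convTest φ η
  have h1 : ∀ y, L (φ y • toBCF _ (translate y η)) = φ y * T (translate y η) := fun y => by
    rw [map_smul, hL, smul_eq_mul]
  refine ⟨by simpa only [h1] using L.integrable_comp hi, ?_⟩
  rw [← hL, h, ← L.integral_comp_comm hi]
  simp only [h1]

/-- The fundamental theorem of calculus along the translations by `t y`, `0 ≤ t ≤ 1`. -/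
theorem apply_sub_translate_eq_integral {T : Current d m} (hT : mass T ≠ ∞) (y : Euc d)
    (η : Form d m) :
    T η - T (translate y η) = ∫ t in (0 : ℝ)..1, T (dirDeriv y (translate (t • y) η)) := by
  obtain ⟨L, hL⟩ := exists_extension_boundedContinuous hT
  have hc : Continuous fun t : ℝ => toBCF _ (translate (t • y) (dirDeriv y η)) :=
    (continuous_toBCF_translate _).comp (continuous_id.smul continuous_const)
  rw [← hL, ← hL, ← map_sub, ← integral_toBCF_dirDeriv,
    ← L.intervalIntegral_comp_comm (hc.intervalIntegrable 0 1)]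
  simp only [hL, dirDeriv_translate]

/-! ### The homotopy estimate for translations -/

/-- The contraction of covectors with the vector `y`. -/
noncomputable def contractCovector (m : ℕ) (y : Euc d) : Covector d (m + 1) →L[ℝ] Covector d m :=
  ContinuousLinearMap.apply ℝ (Covector d m) y ∘L
    (ContinuousAlternatingMap.curryLeftLI (𝕜 := ℝ) (E := Euc d) (F := ℝ) (n := m)
      ).toContinuousLinearMap

theorem contractCovector_apply (y : Euc d) (φ : Covector d (m + 1)) :
    contractCovector m y φ = φ.curryLeft y := rfl

theorem norm_contractCovector_le (y : Euc d) (φ : Covector d (m + 1)) :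
    ‖contractCovector m y φ‖ ≤ ‖y‖ * ‖φ‖ := by
  rw [contractCovector_apply, mul_comm, ← ContinuousAlternatingMap.norm_curryLeft φ]
  exact φ.curryLeft.le_opNorm y

/-- The contraction of a form with the constant vector field `y`. -/
noncomputable def contract (y : Euc d) (η : Form d (m + 1)) : Form d m :=
  TestFunction.postcompCLM (contractCovector m y) η

theorem contract_apply (y : Euc d) (η : Form d (m + 1)) (x : Euc d) :
    contract y η x = contractCovector m y (η x) := rfl

theorem norm_contract_le (y : Euc d) {η : Form d (m + 1)} {B : ℝ} (h : ∀ x, ‖η x‖ ≤ B)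
    (x : Euc d) : ‖contract y η x‖ ≤ ‖y‖ * B :=
  (norm_contractCovector_le y _).trans (by gcongr; exact h x)

/-- Contraction followed by alternation, the algebraic content of Cartan's formula. -/
theorem contractCovector_alternatizeUncurryFin_add (f : Euc d →L[ℝ] Covector d (m + 1))
    (y : Euc d) :
    contractCovector (m + 1) y (ContinuousAlternatingMap.alternatizeUncurryFin f) +
      ContinuousAlternatingMap.alternatizeUncurryFin (contractCovector m y ∘L f) = f y := by
  ext v
  simp only [ContinuousAlternatingMap.add_apply, contractCovector_apply,
    ContinuousAlternatingMap.curryLeft_apply_apply,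
    ContinuousAlternatingMap.alternatizeUncurryFin_apply, ContinuousLinearMap.comp_apply]
  rw [Fin.sum_univ_succ]
  have h : ∀ i : Fin (m + 1), Fin.removeNth i.succ (Matrix.vecCons y v) =
      Matrix.vecCons y (Fin.removeNth i v) := fun i => by
    funext j
    refine Fin.cases ?_ (fun j => ?_) j <;> simp [Fin.removeNth]
  simp [h, pow_succ]

theorem contractCovector_alternatizeUncurryFin_zero (f : Euc d →L[ℝ] Covector d 0) (y : Euc d) :
    contractCovector 0 y (ContinuousAlternatingMap.alternatizeUncurryFin f) = f y := by
  ext v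
  simp [contractCovector_apply, ContinuousAlternatingMap.alternatizeUncurryFin_apply,
    Subsingleton.elim (Fin.removeNth 0 (Matrix.vecCons y v)) v]

/-- Cartan's formula for a constant vector field. -/
theorem dirDeriv_eq_contract_add (y : Euc d) (η : Form d (m + 1)) :
    dirDeriv y η = contract y (extD d (m + 1) η) + extD d m (contract y η) := by
  ext1 x
  have hf : fderiv ℝ (contract y η) x = contractCovector m y ∘L fderiv ℝ η x :=
    ((contractCovector m y).hasFDerivAt.comp x
      (η.contDiff.differentiable (by simp) x).hasFDerivAt).fderiv
  rw [add_apply, dirDeriv_apply, contract_apply, extD_apply, extD_apply, extDeriv, extDeriv, hf,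
    contractCovector_alternatizeUncurryFin_add]

theorem dirDeriv_eq_contract (y : Euc d) (η : Form d 0) :
    dirDeriv y η = contract y (extD d 0 η) := by
  ext1 x
  rw [dirDeriv_apply, contract_apply, extD_apply, extDeriv,
    contractCovector_alternatizeUncurryFin_zero]

theorem abs_apply_dirDeriv_le {T : Current d m} (hT : mass T ≠ ∞) (hbT : boundaryMass T ≠ ∞)
    (y : Euc d) {η : Form d m} (h1 : ∀ x, ‖η x‖ ≤ 1) (h2 : ∀ x, ‖extDeriv η x‖ ≤ 1) :
    |T (dirDeriv y η)| ≤ ‖y‖ * ((mass T).toReal + (boundaryMass T).toReal) := by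
  have hd : |T (contract y (extD d m η))| ≤ (mass T).toReal * (‖y‖ * 1) :=
    abs_apply_le_mass hT (by positivity)
      (norm_contract_le y fun x => by rw [extD_apply]; exact h2 x)
  cases m with
  | zero =>
    rw [dirDeriv_eq_contract]
    have : (boundaryMass T).toReal = 0 := rfl
    rw [this]
    linarith
  | succ m =>
    have hb : |boundary T (contract y η)| ≤ (mass (boundary T)).toReal * (‖y‖ * 1) :=
      abs_apply_le_mass hbT (by positivity) (norm_contract_le y h1)
    have heq : (boundaryMass T).toReal = (mass (boundary T)).toReal := rfl
    rw [dirDeriv_eq_contract_add, map_add, heq]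
    calc _ ≤ |T (contract y (extD d (m + 1) η))| + |boundary T (contract y η)| := abs_add_le _ _
      _ ≤ _ := add_le_add hd hb
      _ = _ := by ring

theorem abs_apply_sub_translate_le {T : Current d m} (hT : mass T ≠ ∞)
    (hbT : boundaryMass T ≠ ∞) (y : Euc d) {η : Form d m} (h1 : ∀ x, ‖η x‖ ≤ 1)
    (h2 : ∀ x, ‖extDeriv η x‖ ≤ 1) :
    |T η - T (translate y η)| ≤ ‖y‖ * ((mass T).toReal + (boundaryMass T).toReal) := by
  rw [apply_sub_translate_eq_integral hT]
  have h3 : ∀ t : ℝ, ‖T (dirDeriv y (translate (t • y) η))‖ ≤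
      ‖y‖ * ((mass T).toReal + (boundaryMass T).toReal) := fun t =>
    abs_apply_dirDeriv_le hT hbT y (fun x => h1 _) fun x => by
      rw [extDeriv, fderiv_translate]
      exact h2 _
  simpa using intervalIntegral.norm_integral_le_of_norm_le_const (a := 0) (b := 1)
    (f := fun t => T (dirDeriv y (translate (t • y) η))) fun t _ => h3 t

/-- Averaging the homotopy estimate: a probability density supported in the ball of radius `ε`
moves a normal current by at most `ε` times its normal mass, in flat norm. -/
theorem abs_apply_sub_convTest_le {T : Current d m} (hT : mass T ≠ ∞)
    (hbT : boundaryMass T ≠ ∞) {φ : Test d ℝ} (hφ0 : ∀ x, 0 ≤ φ x) (hφ1 : ∫ x, φ x = 1) {ε : ℝ}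
    (hε : ∀ x, φ x ≠ 0 → ‖x‖ ≤ ε) {η : Form d m} (h1 : ∀ x, ‖η x‖ ≤ 1)
    (h2 : ∀ x, ‖extDeriv η x‖ ≤ 1) :
    |T η - T (convTest φ _ η)| ≤ ε * ((mass T).toReal + (boundaryMass T).toReal) := by
  obtain ⟨hi, h⟩ := apply_convTest_eq_integral hT φ η
  have hφi := test_integrable φ
  have h3 : (∫ y, φ y * T η) = T η := by rw [integral_mul_const, hφ1, one_mul]
  rw [h, ← h3, ← integral_sub (hφi.mul_const _) hi]
  set N := (mass T).toReal + (boundaryMass T).toReal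
  have hN : 0 ≤ N := by positivity
  calc |∫ y, (φ y * T η - φ y * T (translate y η))| ≤ ∫ y, φ y * (ε * N) := by
        rw [← Real.norm_eq_abs]
        refine norm_integral_le_of_norm_le (hφi.mul_const _) (Eventually.of_forall fun y => ?_)
        rw [← mul_sub, norm_mul, Real.norm_of_nonneg (hφ0 y)]
        by_cases hy : φ y = 0
        · simp [hy]
        · refine mul_le_mul_of_nonneg_left ?_ (hφ0 y)
          exact (abs_apply_sub_translate_le hT hbT y h1 h2).trans
            (mul_le_mul_of_nonneg_right (hε y hy) hN)
    _ = ε * N := by rw [integral_mul_const, hφ1, one_mul]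

/-! ### Smoothing estimates -/

theorem norm_convTest_le {F : Type} [NormedAddCommGroup F] [NormedSpace ℝ F] {φ : Test d ℝ}
    (hφ : ∫ x, ‖φ x‖ = 1) {f : Test d F} {B : ℝ} (h : ∀ x, ‖f x‖ ≤ B) (x : Euc d) :
    ‖convTest φ F f x‖ ≤ B :=
  (norm_convFun_le φ h x).trans_eq (by rw [hφ, one_mul])

theorem norm_extDeriv_convTest_le {φ : Test d ℝ} (hφ : ∫ x, ‖φ x‖ = 1) {η : Form d m} {B : ℝ}
    (h : ∀ x, ‖extDeriv η x‖ ≤ B) (x : Euc d) : ‖extDeriv (convTest φ _ η) x‖ ≤ B := by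
  rw [← extD_apply, extD_convTest]
  exact norm_convTest_le hφ (fun y => by rw [extD_apply]; exact h y) x

/-- The derivative can be put on the kernel. -/
theorem norm_extDeriv_convTest_le_integral_fderiv (φ : Test d ℝ) {η : Form d m}
    (h : ∀ x, ‖η x‖ ≤ 1) (x : Euc d) :
    ‖extDeriv (convTest φ _ η) x‖ ≤ (m + 1) * ∫ y, ‖fderiv ℝ φ y‖ := by
  refine (ContinuousAlternatingMap.norm_alternatizeUncurryFin_le _).trans ?_
  gcongr
  have h1 := (φ.hasCompactSupport.hasFDerivAt_convolution_left (μ := volume)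
    (ContinuousLinearMap.lsmul ℝ ℝ) (φ.contDiff.of_le (by norm_cast))
    (η.continuous.locallyIntegrable) x).fderiv
  change ‖fderiv ℝ (convFun φ η) x‖ ≤ _
  rw [convFun, h1]
  have hi : Integrable (fun y => ‖fderiv ℝ φ y‖) :=
    ((φ.contDiff.continuous_fderiv (by simp)).integrable_of_hasCompactSupport
      (φ.hasCompactSupport.fderiv ℝ)).norm
  refine norm_integral_le_of_norm_le hi (Eventually.of_forall fun y => ?_)
  refine ((ContinuousLinearMap.le_opNorm₂ _ _ _).trans ?_).trans_eq (one_mul _)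
  rw [mul_assoc]
  refine mul_le_mul ((ContinuousLinearMap.norm_precompL_le _ _).trans
    ContinuousLinearMap.opNorm_lsmul_le) ?_ (by positivity) zero_le_one
  exact mul_le_of_le_one_right (norm_nonneg _) (h _)

/-! ### Dyadic mollifiers -/

theorem dyadicScale_apply (Φ : Test d ℝ) (n : ℕ) (x : Euc d) :
    dyadicScale Φ n x = ((2 : ℝ) ^ n) ^ d * Φ ((2 : ℝ) ^ n • x) := rfl

theorem integral_comp_two_pow_smul (n : ℕ) (f : Euc d → ℝ) :
    ((2 : ℝ) ^ n) ^ d * ∫ x, f ((2 : ℝ) ^ n • x) = ∫ x, f x := by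
  rw [Measure.integral_comp_smul_of_nonneg volume f ((2 : ℝ) ^ n) (hR := by positivity),
    finrank_euclideanSpace_fin, smul_eq_mul, mul_inv_cancel_left₀ (by positivity)]

namespace IsMollifier

variable {Φ : Test d ℝ}

theorem reflect_dyadicScale (hΦ : IsMollifier Φ) (n : ℕ) :
    reflect (dyadicScale Φ n) = dyadicScale Φ n := by
  ext1 x
  change dyadicScale Φ n (-x) = _
  rw [dyadicScale_apply, dyadicScale_apply, smul_neg, hΦ.even]

theorem dyadicScale_nonneg (hΦ : IsMollifier Φ) (n : ℕ) (x : Euc d) : 0 ≤ dyadicScale Φ n x :=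
  mul_nonneg (by positivity) (hΦ.nonneg _)

theorem integral_dyadicScale (hΦ : IsMollifier Φ) (n : ℕ) : ∫ x, dyadicScale Φ n x = 1 := by
  simp only [dyadicScale_apply]
  rw [integral_const_mul, integral_comp_two_pow_smul n Φ, hΦ.integral_eq_one]

theorem integral_norm_dyadicScale (hΦ : IsMollifier Φ) (n : ℕ) : ∫ x, ‖dyadicScale Φ n x‖ = 1 := by
  simp only [Real.norm_of_nonneg (hΦ.dyadicScale_nonneg n _)]
  exact hΦ.integral_dyadicScale n

theorem norm_le_of_dyadicScale_ne_zero (hΦ : IsMollifier Φ) (n : ℕ) (x : Euc d)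
    (h : dyadicScale Φ n x ≠ 0) :
    ‖x‖ ≤ ((2 : ℝ) ^ n)⁻¹ := by
  have h1 : Φ ((2 : ℝ) ^ n • x) ≠ 0 := right_ne_zero_of_mul h
  have h2 := hΦ.tsupport_subset_closedBall (subset_closure h1)
  rw [mem_closedBall_zero_iff, norm_smul, Real.norm_of_nonneg (by positivity)] at h2
  rwa [← one_div, le_div_iff₀' (by positivity)]

theorem tsupport_dyadicScale_subset (hΦ : IsMollifier Φ) (n : ℕ) :
    tsupport (dyadicScale Φ n) ⊆ Metric.closedBall 0 1 :=
  closure_minimal (fun x hx => mem_closedBall_zero_iff.2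
    ((hΦ.norm_le_of_dyadicScale_ne_zero n x hx).trans
      (inv_le_one_of_one_le₀ (one_le_pow₀ one_le_two)))) Metric.isClosed_closedBall

end IsMollifier

theorem integral_norm_fderiv_dyadicScale (Φ : Test d ℝ) (n : ℕ) :
    ∫ x, ‖fderiv ℝ (dyadicScale Φ n) x‖ = (2 : ℝ) ^ n * ∫ x, ‖fderiv ℝ Φ x‖ := by
  have h : ∀ x, ‖fderiv ℝ (dyadicScale Φ n) x‖ =
      ((2 : ℝ) ^ n) ^ d * ((2 : ℝ) ^ n * ‖fderiv ℝ Φ ((2 : ℝ) ^ n • x)‖) := fun x => by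
    have h1 : HasFDerivAt (dyadicScale Φ n)
        (((2 : ℝ) ^ n) ^ d • ((2 : ℝ) ^ n • fderiv ℝ Φ ((2 : ℝ) ^ n • x))) x := by
      have h2 := (Φ.contDiff.differentiable (by simp) ((2 : ℝ) ^ n • x)).hasFDerivAt.comp x
        ((hasFDerivAt_id x).const_smul ((2 : ℝ) ^ n))
      rw [ContinuousLinearMap.comp_smul, ContinuousLinearMap.comp_id] at h2
      exact h2.const_mul _
    rw [h1.fderiv, norm_smul, norm_smul, Real.norm_of_nonneg (by positivity),
      Real.norm_of_nonneg (by positivity)]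
  simp only [h]
  rw [integral_const_mul, integral_comp_two_pow_smul n fun x => (2 : ℝ) ^ n * ‖fderiv ℝ Φ x‖,
    integral_const_mul]

/-! ### Mollified normal currents -/

/-- The closed neighbourhood of radius one of `K`, which contains the support of the mollified
currents. -/
def unitThickening (K : Set (Euc d)) : Set (Euc d) := K + Metric.closedBall 0 1

theorem isCompact_unitThickening {K : Set (Euc d)} (hK : IsCompact K) :
    IsCompact (unitThickening K) :=
  hK.add (isCompact_closedBall 0 1)

theorem subset_unitThickening (K : Set (Euc d)) : K ⊆ unitThickening K := fun x hx =>
  ⟨x, hx, 0, by simp, add_zero x⟩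

/-- A normal current over `K`, as a normal current over the unit neighbourhood of `K`. -/
noncomputable def thicken {K : Set (Euc d)} (T : normalCurrents d m K) :
    normalCurrents d m (unitThickening K) :=
  Submodule.inclusion (normalCurrents_mono (subset_unitThickening K)) T

/-- The mollified current `T * Φ_{2^{-n}}`. -/
noncomputable def mollify {Φ : Test d ℝ} (hΦ : IsMollifier Φ) {K : Set (Euc d)}
    (T : normalCurrents d m K) (n : ℕ) : normalCurrents d m (unitThickening K) :=
  ⟨(T : Current d m).conv (dyadicScale Φ n),
    (conv_mem (normalCurrents_mono (subset_univ K) T.2) _).1,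
    (conv_mem (normalCurrents_mono (subset_univ K) T.2) _).2.1,
    (spt_conv _ T.2.1 _).trans (add_subset_add T.2.2.2 (hΦ.tsupport_dyadicScale_subset n))⟩

section Mollify

variable {Φ : Test d ℝ} (hΦ : IsMollifier Φ) {K : Set (Euc d)} (T : normalCurrents d m K) (n : ℕ)

theorem nMass_thicken : nMass (thicken T) = nMass T := rfl

theorem mollify_apply (η : Form d m) : (mollify hΦ T n : Current d m) η =
    (T : Current d m) (convTest (dyadicScale Φ n) _ η) := by
  change (T : Current d m) (convTest (reflect (dyadicScale Φ n)) _ η) = _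
  rw [hΦ.reflect_dyadicScale]

theorem boundary_mollify_apply {m : ℕ} (T : normalCurrents d (m + 1) K) (η : Form d m) :
    boundary (mollify hΦ T n : Current d (m + 1)) η =
      boundary (T : Current d (m + 1)) (convTest (dyadicScale Φ n) _ η) := by
  change (mollify hΦ T n : Current d (m + 1)) (extD d m η) = _
  rw [mollify_apply, ← extD_convTest]
  rfl

theorem nMass_mollify_le : nMass (mollify hΦ T n) ≤ nMass T := by
  have hφ := hΦ.integral_norm_dyadicScale n
  rw [nMass_eq, nMass_eq]
  refine add_le_add (mass_toReal_le ENNReal.toReal_nonneg fun η hη => ?_) ?_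
  · rw [mollify_apply]
    simpa using apply_le_mass (mass_ne_top T) zero_le_one (norm_convTest_le hφ hη)
  · cases m with
    | zero => exact le_rfl
    | succ m =>
      refine mass_toReal_le ENNReal.toReal_nonneg fun η hη => ?_
      rw [boundary_mollify_apply]
      exact (apply_le_mass (boundaryMass_ne_top T) zero_le_one (norm_convTest_le hφ hη)).trans_eq
        (mul_one _)

theorem fNorm_mollify_le : fNorm (mollify hΦ T n) ≤ fNorm T := by
  have hφ := hΦ.integral_norm_dyadicScale n
  refine fNorm_le (fNorm_nonneg T) fun η h1 h2 => ?_
  rw [mollify_apply]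
  simpa using apply_le_fNorm T zero_le_one (norm_convTest_le hφ h1)
    (norm_extDeriv_convTest_le hφ h2)

/-- Mollification at scale `2^{-n}` controls the normal mass by the flat norm at the cost of a
factor `2^n`. -/
theorem nMass_mollify_le_fNorm : nMass (mollify hΦ T n) ≤
    (1 + 2 * ((m + 1) * ∫ y, ‖fderiv ℝ Φ y‖)) * (2 : ℝ) ^ n * fNorm T := by
  have hφ := hΦ.integral_norm_dyadicScale n
  have hF := fNorm_nonneg T
  set I : ℝ := ∫ y, ‖fderiv ℝ Φ y‖ with hI
  have hI0 : 0 ≤ I := integral_nonneg fun _ => norm_nonneg _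
  have h2n : (1 : ℝ) ≤ 2 ^ n := one_le_pow₀ one_le_two
  have hd : ∀ (k : ℕ) (η : Form d k), (∀ x, ‖η x‖ ≤ 1) → ∀ x,
      ‖extDeriv (convTest (dyadicScale Φ n) _ η) x‖ ≤ (k + 1) * I * 2 ^ n := fun k η hη x => by
    refine (norm_extDeriv_convTest_le_integral_fderiv _ hη x).trans_eq ?_
    rw [integral_norm_fderiv_dyadicScale]
    ring
  have hM : (mass (mollify hΦ T n : Current d m)).toReal ≤
      fNorm T * ((1 + (m + 1) * I) * 2 ^ n) := by
    refine mass_toReal_le (by positivity) fun η hη => ?_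
    rw [mollify_apply]
    have h3 : 0 ≤ (m + 1) * I * 2 ^ n := by positivity
    refine apply_le_fNorm T (by positivity) (fun x => (norm_convTest_le hφ hη x).trans ?_)
      fun x => (hd m η hη x).trans ?_
    · linarith
    · linarith
  have hB : (boundaryMass (mollify hΦ T n : Current d m)).toReal ≤
      fNorm T * ((m + 1) * I * 2 ^ n) := by
    cases m with
    | zero =>
      change (0 : ℝ≥0∞).toReal ≤ _
      simp only [ENNReal.toReal_zero]
      positivity
    | succ m =>
      refine mass_toReal_le (by positivity) fun η hη => ?_
      rw [boundary_mollify_apply]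
      change (T : Current d (m + 1)) (extD d m (convTest (dyadicScale Φ n) _ η)) ≤ _
      refine apply_le_fNorm T (by positivity) (fun x => ?_) fun x => ?_
      · rw [extD_apply]
        refine (hd m η hη x).trans ?_
        push_cast
        gcongr
        linarith
      · have h0 : (extD d m (convTest (dyadicScale Φ n) _ η) : Euc d → Covector d (m + 1)) =
            extDeriv (convTest (dyadicScale Φ n) _ η) := funext fun y => extD_apply _ y
        rw [h0, extDeriv_extDeriv (convTest (dyadicScale Φ n) _ η).contDiff
          (by
            rw [minSmoothness_of_isRCLikeNormedField]
            exact WithTop.coe_le_coe.2 (le_top : (2 : ℕ∞) ≤ ⊤))]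
        simp only [Pi.zero_apply, norm_zero]
        positivity
  rw [nMass_eq]
  calc _ ≤ fNorm T * ((1 + (m + 1) * I) * 2 ^ n) + fNorm T * ((m + 1) * I * 2 ^ n) :=
        add_le_add hM hB
    _ = _ := by ring

theorem fNorm_thicken_sub_mollify_le :
    fNorm (thicken T - mollify hΦ T n) ≤ ((2 : ℝ) ^ n)⁻¹ * nMass T := by
  refine fNorm_le (mul_nonneg (by positivity) (nMass_nonneg T)) fun η h1 h2 => ?_
  have h3 : ((thicken T - mollify hΦ T n : normalCurrents d m (unitThickening K)) :
      Current d m) η = (T : Current d m) η - (mollify hΦ T n : Current d m) η := rfl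
  rw [h3, mollify_apply, nMass_eq]
  exact (le_abs_self _).trans (abs_apply_sub_convTest_le (mass_ne_top T) (boundaryMass_ne_top T)
    (hΦ.dyadicScale_nonneg n) (hΦ.integral_dyadicScale n)
    (hΦ.norm_le_of_dyadicScale_ne_zero n) h1 h2)

theorem nMass_thicken_sub_mollify_le : nMass (thicken T - mollify hΦ T n) ≤ 2 * nMass T := by
  have h1 := nMass_sub_le (thicken T) (mollify hΦ T n)
  have h2 := nMass_mollify_le hΦ T n
  rw [nMass_thicken] at h1
  linarith

theorem restrictCharge_conv_apply (ω : Cochain d m univ) :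
    restrictCharge K (ω.conv (dyadicScale Φ n)) T =
      restrictCharge (unitThickening K) ω (mollify hΦ T n) := by
  refine congrArg ω (Subtype.ext ?_)
  change (T : Current d m).conv (reflect (dyadicScale Φ n)) =
    (T : Current d m).conv (dyadicScale Φ n)
  rw [hΦ.reflect_dyadicScale]

end Mollify

/-! ### Estimates for the Littlewood-Paley pieces -/

theorem two_pow_rpow (n : ℕ) (s : ℝ) : ((2 : ℝ) ^ n) ^ s = (2 : ℝ) ^ ((n : ℝ) * s) := by
  rw [Real.rpow_mul zero_le_two, Real.rpow_natCast]

/-- A fractional charge on a current whose flat norm is smaller by a factor `δ` than its normal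
mass. -/
theorem FracBound.abs_apply_le_rpow {α C : ℝ} (hα0 : 0 < α) (hα1 : α < 1) (hC : 0 ≤ C)
    {ω : Cochain d m X} (hω : FracBound α C ω) {S : normalCurrents d m X} {N δ : ℝ} (hN : 0 ≤ N)
    (hδ : 0 ≤ δ) (h1 : nMass S ≤ N) (h2 : fNorm S ≤ δ * N) : |ω S| ≤ C * δ ^ α * N := by
  have hS := nMass_nonneg S
  have hF := fNorm_nonneg S
  calc |ω S| ≤ C * nMass S ^ (1 - α) * fNorm S ^ α := hω S
    _ ≤ C * N ^ (1 - α) * (δ * N) ^ α := by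
      have : 0 ≤ 1 - α := by linarith
      gcongr
    _ = C * δ ^ α * (N ^ (1 - α) * N ^ α) := by rw [Real.mul_rpow hδ hN]; ring
    _ = C * δ ^ α * N := by
      rw [← Real.rpow_add_of_nonneg hN (by linarith) hα0.le, sub_add_cancel, Real.rpow_one]

section LittlewoodPaley

variable {α : ℝ} {Φ : Test d ℝ} {K : Set (Euc d)} {ω : Cochain d m univ} {C A : ℝ}

/-- The charge `ω * Φ_{2^{-n}}` is Lipschitz for the flat norm, with constant `2^{n(1-α)}`. -/
theorem abs_conv_dyadicScale_le (hΦ : IsMollifier Φ) (hα0 : 0 < α) (hα1 : α < 1) (hC : 0 ≤ C)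
    (hω : FracBound α C (restrictCharge (unitThickening K) ω)) (hA0 : 0 ≤ A)
    (hA : 1 + 2 * ((m + 1) * ∫ y, ‖fderiv ℝ Φ y‖) ≤ A) (n : ℕ) (T : normalCurrents d m K) :
    |restrictCharge K (ω.conv (dyadicScale Φ n)) T| ≤
      C * A ^ (1 - α) * (2 : ℝ) ^ ((n : ℝ) * (1 - α)) * fNorm T := by
  have hF := fNorm_nonneg T
  have hα : 0 ≤ 1 - α := by linarith
  rw [restrictCharge_conv_apply hΦ]
  have h1 : nMass (mollify hΦ T n) ≤ A * 2 ^ n * fNorm T :=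
    (nMass_mollify_le_fNorm hΦ T n).trans (by gcongr)
  calc _ ≤ C * nMass (mollify hΦ T n) ^ (1 - α) * fNorm (mollify hΦ T n) ^ α := hω _
    _ ≤ C * (A * 2 ^ n * fNorm T) ^ (1 - α) * fNorm T ^ α := by
      have h2 := fNorm_mollify_le hΦ T n
      have h3 := fNorm_nonneg (mollify hΦ T n)
      have h4 := nMass_nonneg (mollify hΦ T n)
      gcongr
    _ = C * A ^ (1 - α) * (2 : ℝ) ^ ((n : ℝ) * (1 - α)) * (fNorm T ^ (1 - α) * fNorm T ^ α) := by
      rw [Real.mul_rpow (by positivity) hF, Real.mul_rpow hA0 (by positivity), two_pow_rpow]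
      ring
    _ = _ := by rw [← Real.rpow_add_of_nonneg hF hα hα0.le, sub_add_cancel, Real.rpow_one]

theorem lpPiece_fracBound_one (hΦ : IsMollifier Φ) (hα0 : 0 < α) (hα1 : α < 1) (hC : 0 ≤ C)
    (hω : FracBound α C (restrictCharge (unitThickening K) ω)) (hA0 : 0 ≤ A)
    (hA : 1 + 2 * ((m + 1) * ∫ y, ‖fderiv ℝ Φ y‖) ≤ A) (n : ℕ) :
    FracBound 1 (2 * (C * A ^ (1 - α)) * (2 : ℝ) ^ ((n : ℝ) * (1 - α)))
      (restrictCharge K (lpPiece Φ ω n)) := by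
  intro T
  have hF := fNorm_nonneg T
  have hα : 0 ≤ 1 - α := by linarith
  have key := fun n => abs_conv_dyadicScale_le hΦ hα0 hα1 hC hω hA0 hA n T
  rw [sub_self, Real.rpow_zero, mul_one, Real.rpow_one]
  cases n with
  | zero =>
    have h0 : 0 ≤ C * A ^ (1 - α) * (2 : ℝ) ^ (((0 : ℕ) : ℝ) * (1 - α)) * fNorm T := by positivity
    exact (key 0).trans (by linarith)
  | succ n =>
    have h1 : (2 : ℝ) ^ ((n : ℝ) * (1 - α)) ≤ (2 : ℝ) ^ (((n + 1 : ℕ) : ℝ) * (1 - α)) := by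
      refine Real.rpow_le_rpow_of_exponent_le one_le_two ?_
      gcongr
      exact n.le_succ
    change |restrictCharge K (ω.conv (dyadicScale Φ (n + 1))) T -
      restrictCharge K (ω.conv (dyadicScale Φ n)) T| ≤ _
    calc _ ≤ _ := abs_sub _ _
      _ ≤ _ := add_le_add (key (n + 1)) (key n)
      _ ≤ C * A ^ (1 - α) * (2 : ℝ) ^ (((n + 1 : ℕ) : ℝ) * (1 - α)) * fNorm T +
          C * A ^ (1 - α) * (2 : ℝ) ^ (((n + 1 : ℕ) : ℝ) * (1 - α)) * fNorm T := by gcongr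
      _ = _ := by ring

theorem inv_two_pow_rpow (n : ℕ) (α : ℝ) :
    (((2 : ℝ) ^ n)⁻¹) ^ α = ((2 : ℝ) ^ ((n : ℝ) * α))⁻¹ := by
  rw [Real.inv_rpow (by positivity), two_pow_rpow]

/-- The charge `ω * Φ_{2^{-n}}` approximates `ω` at rate `2^{-nα}` in the charge norm. -/
theorem abs_conv_dyadicScale_sub_le (hΦ : IsMollifier Φ) (hα0 : 0 < α) (hα1 : α < 1) (hC : 0 ≤ C)
    (hω : FracBound α C (restrictCharge (unitThickening K) ω)) (n : ℕ)
    (T : normalCurrents d m K) :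
    |restrictCharge K (ω.conv (dyadicScale Φ n) - ω) T| ≤
      2 * C / (2 : ℝ) ^ ((n : ℝ) * α) * nMass T := by
  have hN := nMass_nonneg T
  have h1 : restrictCharge K (ω.conv (dyadicScale Φ n) - ω) T =
      -restrictCharge (unitThickening K) ω (thicken T - mollify hΦ T n) := by
    rw [cochain_sub_apply, ← restrictCharge_conv_apply, neg_sub]
    rfl
  have h2 := hω.abs_apply_le_rpow hα0 hα1 hC (N := 2 * nMass T) (δ := ((2 : ℝ) ^ n)⁻¹)
    (by positivity) (by positivity) (nMass_thicken_sub_mollify_le hΦ T n)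
    ((fNorm_thicken_sub_mollify_le hΦ T n).trans (by gcongr; linarith))
  rw [h1, abs_neg]
  refine h2.trans_eq ?_
  rw [inv_two_pow_rpow]
  ring

theorem abs_lpPiece_le (hΦ : IsMollifier Φ) (hα0 : 0 < α) (hα1 : α < 1) (hC : 0 ≤ C)
    (hω : FracBound α C (restrictCharge (unitThickening K) ω)) (n : ℕ)
    (T : normalCurrents d m K) :
    |restrictCharge K (lpPiece Φ ω n) T| ≤ 6 * C / (2 : ℝ) ^ ((n : ℝ) * α) * nMass T := by
  have hN := nMass_nonneg T
  have key := fun n => abs_conv_dyadicScale_sub_le hΦ hα0 hα1 hC hω n T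
  cases n with
  | zero =>
    have h1 : |restrictCharge K (ω.conv (dyadicScale Φ 0)) T| ≤ C * nMass (mollify hΦ T 0) := by
      rw [restrictCharge_conv_apply hΦ]
      exact hω.abs_apply_le_nMass hα0 hC _
    refine h1.trans ?_
    have h2 : C * nMass (mollify hΦ T 0) ≤ C * nMass T := by
      gcongr
      exact nMass_mollify_le hΦ T 0
    have h3 : 0 ≤ C * nMass T := by positivity
    simp only [Nat.cast_zero, zero_mul, Real.rpow_zero, div_one]
    linarith
  | succ n =>
    -- two consecutive scales differ by a factor `2^α ≤ 2`
    have h1 : ((2 : ℝ) ^ ((n : ℝ) * α))⁻¹ ≤ 2 * ((2 : ℝ) ^ (((n + 1 : ℕ) : ℝ) * α))⁻¹ := by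
      have h2 : (2 : ℝ) ^ (((n + 1 : ℕ) : ℝ) * α) = (2 : ℝ) ^ ((n : ℝ) * α) * (2 : ℝ) ^ α := by
        rw [← Real.rpow_add two_pos]
        push_cast
        ring_nf
      have h3 : (2 : ℝ) ^ α ≤ 2 := by
        simpa using Real.rpow_le_rpow_of_exponent_le one_le_two hα1.le
      rw [h2, mul_inv, ← mul_assoc, mul_comm (2 : ℝ), mul_assoc]
      refine le_mul_of_one_le_right (by positivity) ?_
      rwa [← div_eq_mul_inv, one_le_div (by positivity)]
    have h4 : restrictCharge K (lpPiece Φ ω (n + 1)) T =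
        restrictCharge K (ω.conv (dyadicScale Φ (n + 1)) - ω) T -
          restrictCharge K (ω.conv (dyadicScale Φ n) - ω) T := by
      simp only [lpPiece, restrictCharge_sub, LinearMap.sub_apply]
      ring
    rw [h4]
    calc _ ≤ _ := abs_sub _ _
      _ ≤ _ := add_le_add (key (n + 1)) (key n)
      _ = 2 * C * ((2 : ℝ) ^ (((n + 1 : ℕ) : ℝ) * α))⁻¹ * nMass T +
          2 * C * ((2 : ℝ) ^ ((n : ℝ) * α))⁻¹ * nMass T := by rw [div_eq_mul_inv, div_eq_mul_inv]
      _ ≤ 2 * C * ((2 : ℝ) ^ (((n + 1 : ℕ) : ℝ) * α))⁻¹ * nMass T +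
          2 * C * (2 * ((2 : ℝ) ^ (((n + 1 : ℕ) : ℝ) * α))⁻¹) * nMass T := by gcongr
      _ = _ := by rw [div_eq_mul_inv]; ring

theorem sum_range_succ_lpPiece (Φ : Test d ℝ) (ω : Cochain d m univ) (p : ℕ) :
    ∑ n ∈ Finset.range (p + 1), lpPiece Φ ω n = ω.conv (dyadicScale Φ p) := by
  induction p with
  | zero => simp [lpPiece]
  | succ p ih => rw [Finset.sum_range_succ, ih, lpPiece, add_sub_cancel]

theorem exists_lpPiece_bounds (hΦ : IsMollifier Φ) (hα0 : 0 < α) (hα1 : α < 1)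
    (hω : IsGlobalFractionalCharge α ω) (hK : IsCompact K) :
    ∃ C : ℝ, 0 ≤ C ∧ ∀ n : ℕ,
      fracNorm 1 (restrictCharge K (lpPiece Φ ω n)) ≤
        ENNReal.ofReal (C * (2 : ℝ) ^ ((n : ℝ) * (1 - α))) ∧
      chargeNorm (restrictCharge K (lpPiece Φ ω n)) ≤
        ENNReal.ofReal (C / (2 : ℝ) ^ ((n : ℝ) * α)) := by
  obtain ⟨C, hC, hCω⟩ := hω.2 _ (isCompact_unitThickening hK)
  have hI : 0 ≤ ∫ y, ‖fderiv ℝ Φ y‖ := integral_nonneg fun _ => norm_nonneg _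
  set A : ℝ := 1 + 2 * ((m + 1) * ∫ y, ‖fderiv ℝ Φ y‖) with hA
  have hA0 : 0 ≤ A := by positivity
  refine ⟨2 * (C * A ^ (1 - α)) + 6 * C, by positivity, fun n => ⟨?_, ?_⟩⟩
  · refine (fracNorm_le_of_fracBound (by positivity)
      (lpPiece_fracBound_one hΦ hα0 hα1 hC hCω hA0 hA.ge n)).trans ?_
    gcongr
    exact le_add_of_nonneg_right (by positivity)
  · refine (chargeNorm_le (by positivity) (abs_lpPiece_le hΦ hα0 hα1 hC hCω n)).trans ?_
    gcongr
    exact le_add_of_nonneg_left (by positivity)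

theorem isGlobalFractionalCharge_lpPiece (hΦ : IsMollifier Φ) (hα0 : 0 < α) (hα1 : α < 1)
    (hω : IsGlobalFractionalCharge α ω) (n : ℕ) : IsGlobalFractionalCharge 1 (lpPiece Φ ω n) :=
  isGlobalFractionalCharge_of_forall one_pos fun _ hK => by
    obtain ⟨C, hC, h⟩ := exists_lpPiece_bounds hΦ hα0 hα1 hω hK
    exact ⟨_, by positivity, fracBound_of_fracNorm_le (by positivity) (h n).1⟩

theorem globalWeakStarTendsto_sum_lpPiece (hΦ : IsMollifier Φ) (hα0 : 0 < α) (hα1 : α < 1)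
    (hω : IsGlobalFractionalCharge α ω) :
    GlobalWeakStarTendsto α (fun p => ∑ n ∈ Finset.range p, lpPiece Φ ω n) ω := by
  refine globalWeakStarTendsto_of_forall hα0 fun K hK => ?_
  obtain ⟨B, hB, h⟩ := exists_lpPiece_bounds hΦ hα0 hα1 hω hK
  obtain ⟨h1, -, h2, -⟩ := weakStarTendsto_sumCochain hα0 hα1 hB (fun n => (h n).1)
    (fun n => (h n).2) (summable_apply_of_chargeNorm_le hα0 hB fun n => (h n).2)
  simp only [← restrictCharge_sum] at h1 h2
  refine ⟨h1, hω.2 K hK, h2, (tendsto_add_atTop_iff_nat 1).1 ?_⟩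
  obtain ⟨C, hC, hCω⟩ := hω.2 _ (isCompact_unitThickening hK)
  have hlim : Tendsto (fun n : ℕ => ENNReal.ofReal (2 * C / (2 : ℝ) ^ ((n : ℝ) * α)))
      atTop (𝓝 0) := by
    rw [← ENNReal.ofReal_zero]
    exact ENNReal.tendsto_ofReal (summable_dyadic hα0 (2 * C)).tendsto_atTop_zero
  refine tendsto_of_tendsto_of_tendsto_of_le_of_le tendsto_const_nhds hlim (fun _ => zero_le)
    fun p => ?_
  simp only [sum_range_succ_lpPiece]
  exact chargeNorm_le (by positivity) (abs_conv_dyadicScale_sub_le hΦ hα0 hα1 hC hCω p)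

end LittlewoodPaley

end FractionalCharge

theorem proposition5p2 (α : ℝ) (hα0 : 0 < α) (hα1 : α < 1) :
    ∃ Cα : ℝ, 0 ≤ Cα ∧ ∀ d m : ℕ, 1 ≤ d →
      -- charges over a compact set
      (∀ (K : Set (Euc d)), IsCompact K → ∀ (ω : ℕ → Cochain d m K) (C : ℝ), 0 ≤ C →
        (∀ n, IsFractionalCharge 1 (ω n)) →
        (∀ n : ℕ, fracNorm 1 (ω n) ≤ ENNReal.ofReal (C * (2 : ℝ) ^ ((n : ℝ) * (1 - α)))) →
        (∀ n : ℕ, chargeNorm (ω n) ≤ ENNReal.ofReal (C / (2 : ℝ) ^ ((n : ℝ) * α))) →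
        ∃ ω' : Cochain d m K,
          WeakStarTendsto α (fun p => ∑ n ∈ Finset.range p, ω n) ω' ∧
          fracNorm α ω' ≤ ENNReal.ofReal (Cα * C)) ∧
      -- charges over the whole space, with locally uniform constants
      (∀ (ω : ℕ → Cochain d m Set.univ) (C : Set (Euc d) → ℝ),
        (∀ K, IsCompact K → 0 ≤ C K) →
        (∀ n, IsGlobalFractionalCharge 1 (ω n)) →
        (∀ K, IsCompact K → ∀ n : ℕ, fracNorm 1 (restrictCharge K (ω n)) ≤
          ENNReal.ofReal (C K * (2 : ℝ) ^ ((n : ℝ) * (1 - α)))) →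
        (∀ K, IsCompact K → ∀ n : ℕ, chargeNorm (restrictCharge K (ω n)) ≤
          ENNReal.ofReal (C K / (2 : ℝ) ^ ((n : ℝ) * α))) →
        ∃ ω' : Cochain d m Set.univ,
          GlobalWeakStarTendsto α (fun p => ∑ n ∈ Finset.range p, ω n) ω' ∧
          ∀ K, IsCompact K → fracNorm α (restrictCharge K ω') ≤ ENNReal.ofReal (Cα * C K)) ∧
      -- the Littlewood-Paley decomposition of a fractional charge
      (∀ (Φ : Test d ℝ), IsMollifier Φ → ∀ ω : Cochain d m Set.univ, IsGlobalFractionalCharge α ω →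
        (∀ n, IsGlobalFractionalCharge 1 (lpPiece Φ ω n)) ∧
        (∀ K, IsCompact K → ∃ C : ℝ, 0 ≤ C ∧ ∀ n : ℕ,
          fracNorm 1 (restrictCharge K (lpPiece Φ ω n)) ≤
            ENNReal.ofReal (C * (2 : ℝ) ^ ((n : ℝ) * (1 - α))) ∧
          chargeNorm (restrictCharge K (lpPiece Φ ω n)) ≤
            ENNReal.ofReal (C / (2 : ℝ) ^ ((n : ℝ) * α))) ∧
        GlobalWeakStarTendsto α (fun p => ∑ n ∈ Finset.range p, lpPiece Φ ω n) ω) := by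
  refine ⟨dyadicConst α, dyadicConst_nonneg hα0 hα1, fun d m _ =>
    ⟨fun K _ ω C hC _ h1 h2 => ?_, fun ω C hC _ h1 h2 =>
      exists_globalWeakStarTendsto_sum hα0 hα1 hC h1 h2, fun Φ hΦ ω hω =>
      ⟨isGlobalFractionalCharge_lpPiece hΦ hα0 hα1 hω,
        fun K hK => exists_lpPiece_bounds hΦ hα0 hα1 hω hK,
        globalWeakStarTendsto_sum_lpPiece hΦ hα0 hα1 hω⟩⟩⟩
  have hs := summable_apply_of_chargeNorm_le hα0 hC h2
  exact ⟨sumCochain ω hs, weakStarTendsto_sumCochain hα0 hα1 hC h1 h2 hs,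
    fracNorm_le_of_fracBound (mul_nonneg (dyadicConst_nonneg hα0 hα1) hC)
      (sumCochain_fracBound hα0 hα1 hC h1 h2 hs)⟩
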